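/- Let $\mathcal X\subseteq\mathbb R^d$ be measurable and let $p$ be a probability density on $\mathcal X$, positive and differentiable at every point of $\mathcal X$. For a differentiable scalar function $g$ and $1\le j\le d$ put $\mathcal A_{x^j}g(x)=\partial_j\log p(x)\,g(x)+\partial_j g(x)$, and $\mathcal A_x g=(\mathcal A_{x^1}g,\dots,\mathcal A_{x^d}g)$. Let $p_w$ be a probability distribution on a measurable space $\mathcal W$, and let $\phi(x,w)$ be jointly measurable features, differentiable in $x$ at every point of $\mathcal X$, that satisfy the zero-boundary condition: for each $w$ and each $\eta>0$ there is a compact subset $K$ of the interior of $\mathcal X$ with $|p(x)\phi(x,w)|<\eta$ for all $x\in\mathcal X\setminus K$. Let $m,n\ge1$, let $w_1,\dots,w_m$ be i.i.d. with law $p_w$, and let $X^*=(x_1^*,\dots,x_n^*)$ be points of $\mathcal X$, possibly random and depending arbitrarily on $w_1,\dots,w_m$, with empirical mean $\mathbb E_{\hat\mu_{X^*}}f=\frac1n\sum_{i=1}^n f(x_i^*)$. Assume that there are constants $\epsilon_j,M_j,R_j$ ($1\le j\le d$) such that: 1. almost surely, $|\mathbb E_{x\sim\hat\mu_{X^*}}\mathcal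 A_{x^j}\phi(x,w_\ell)|\le\epsilon_j/\sqrt m$ for all $j$ and all $\ell\le m$; 2. $\sup_{x\in\mathcal X,\,w\in\mathcal W}|\mathcal A_{x^j}\phi(x,w)|=M_j<\infty$ for all $j$; 3. for all $j$, the class $\mathcal F_j=\{w\mapsto\mathcal A_{x^j}\phi(x,w):x\in\mathcal X\}$ has Rademacher complexity $\mathbb E\big[\sup_{g\in\mathcal F_j}\frac1m\sum_{\ell=1}^m\sigma_\ell g(w_\ell)\big]\le R_j/\sqrt m$, where $\sigma_1,\dots,\sigma_m$ are independent uniform signs, independent of the $w_\ell$. Put $\epsilon=(\sum_j\epsilon_j^2)^{1/2}$, $M=(\sum_jM_j^2)^{1/2}$ and $R=(\sum_jR_j^2)^{1/2}$. Let $\mathcal F_\infty$ be the set of functions $f$ on $\mathcal X$ of the form $f(x)=\mathbb E_{w\sim p_w}[v(w)^\top\mathcal A_x\phi(x,w)]$ with measurable weights $v:\mathcal W\to\mathbb R^d$ such that $\sup_w\|v(w)\|_\infty<\infty$, and let $\|f\|_{\mathcal F_\infty}^2=\inf_v\sum_{j=1}^d\sup_w|v_j(w)|^2$, the infimum being over all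 such $v$ that represent $f$. Then there is a constant $C>0$ that depends only on $R$ and $M$ such that every fixed $f\in\mathcal F_\infty$ with $\|f\|_{\mathcal F_\infty}\le1$ is $p$-integrable and, for every $\delta\in(0,1]$, with probability at least $1-\delta$ over the random features, $$\left|\mathbb E_{\hat\mu_{X^*}}f-\mathbb E_pf\right|\le\frac{C}{\sqrt m}\left(1+\epsilon+\sqrt{2\log(1/\delta)}\right).$$ (If the particles do not depend measurably on the randomness, this means that the exceptional event has outer probability at most $\delta$.) -/

import Mathlib

open MeasureTheory ProbabilityTheory

noncomputable section

/-- The target: a differentiable density `p`, positive on the domain `X ⊆ ℝᵈ`. -/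
structure IsTargetDensity {d : ℕ} (X : Set (EuclideanSpace ℝ (Fin d)))
    (p : EuclideanSpace ℝ (Fin d) → ℝ) : Prop where
  measurableSet : MeasurableSet X
  pos : ∀ x ∈ X, 0 < p x
  differentiableAt : ∀ x ∈ X, DifferentiableAt ℝ p x
  lintegral_eq_one : ∫⁻ x in X, ENNReal.ofReal (p x) = 1

/-- The probability measure on `X` with Lebesgue density `p`. -/
def targetMeasure {d : ℕ} (X : Set (EuclideanSpace ℝ (Fin d)))
    (p : EuclideanSpace ℝ (Fin d) → ℝ) : Measure (EuclideanSpace ℝ (Fin d)) :=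
  (volume.restrict X).withDensity fun x => ENNReal.ofReal (p x)

/-- `j`-th coordinate of the Stein operator applied to the scalar function `g`:
`∂ⱼ (log p) (x) * g x + ∂ⱼ g (x)`. -/
def steinOp {d : ℕ} (p : EuclideanSpace ℝ (Fin d) → ℝ) (j : Fin d)
    (g : EuclideanSpace ℝ (Fin d) → ℝ) (x : EuclideanSpace ℝ (Fin d)) : ℝ :=
  fderiv ℝ (fun y => Real.log (p y)) x (EuclideanSpace.single j 1) * g x +
    fderiv ℝ g x (EuclideanSpace.single j 1)

/-- `g` tends to zero at the boundary of `X` and, if `X` is unbounded, at infinity: outside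
compact subsets of the interior of `X`, the function is arbitrarily small on `X`. -/
def VanishesAtBoundary {d : ℕ} (X : Set (EuclideanSpace ℝ (Fin d)))
    (g : EuclideanSpace ℝ (Fin d) → ℝ) : Prop :=
  ∀ η : ℝ, 0 < η → ∃ K : Set (EuclideanSpace ℝ (Fin d)),
    IsCompact K ∧ K ⊆ interior X ∧ ∀ x ∈ X, x ∉ K → |g x| < η

/-- A family of features `φ (·, w)`: measurable, differentiable in `x`, and such that
`p * φ (·, w)` satisfies the zero-boundary condition on `X`. -/
structure IsFeatureFamily {d : ℕ} {W : Type*} [MeasurableSpace W]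
    (X : Set (EuclideanSpace ℝ (Fin d))) (p : EuclideanSpace ℝ (Fin d) → ℝ)
    (φ : EuclideanSpace ℝ (Fin d) → W → ℝ) : Prop where
  measurable : Measurable (Function.uncurry φ)
  differentiableAt : ∀ w, ∀ x ∈ X, DifferentiableAt ℝ (fun y => φ y w) x
  boundary : ∀ w, VanishesAtBoundary X fun x => p x * φ x w

/-- Expectation of `f` under the empirical measure of the particles `x₁, …, xₙ`. -/
def empiricalMean {E : Type*} {n : ℕ} (x : Fin n → E) (f : E → ℝ) : ℝ :=
  (1 / (n : ℝ)) * ∑ i, f (x i)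

/-- Empirical Rademacher complexity of `F` on the sample `w₁, …, wₘ`:
`𝔼_σ sup_{g ∈ F} (1/m) ∑ₗ σₗ g (wₗ)`, the signs `σₗ = ±1` being independent and uniform. -/
def empiricalRademacher {W : Type*} {m : ℕ} (F : Set (W → ℝ)) (w : Fin m → W) : ℝ :=
  (1 / (2 : ℝ) ^ m) * ∑ σ : Fin m → ℤˣ,
    ⨆ g : F, (1 / (m : ℝ)) * ∑ l, ((σ l : ℤ) : ℝ) * g.1 (w l)

/-- Rademacher complexity `R_m(F)`: the expectation of the empirical Rademacher complexity over
an i.i.d. sample of size `m` from `μ`. -/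
def rademacherComplexity {W : Type*} [MeasurableSpace W] (μ : Measure W) (m : ℕ)
    (F : Set (W → ℝ)) : ℝ :=
  ∫ w : Fin m → W, empiricalRademacher F w ∂(Measure.pi fun _ => μ)

/-- The class of functions `w ↦ 𝒜_{xʲ} φ (x, w)`, `x ∈ X`. -/
def steinClass {d : ℕ} {W : Type*} (X : Set (EuclideanSpace ℝ (Fin d)))
    (p : EuclideanSpace ℝ (Fin d) → ℝ) (φ : EuclideanSpace ℝ (Fin d) → W → ℝ) (j : Fin d) :
    Set (W → ℝ) :=
  {g | ∃ x ∈ X, g = fun w => steinOp p j (fun y => φ y w) x}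

/-- The assumption on the random features and on the approximate fixed point. The particles may
depend on the features (and on further randomness) in an arbitrary way. -/
structure RandomFeatureAssumption {d m n : ℕ} {Ω W : Type*} [MeasurableSpace Ω]
    [MeasurableSpace W] (P : Measure Ω) (μ : Measure W)
    (X : Set (EuclideanSpace ℝ (Fin d))) (p : EuclideanSpace ℝ (Fin d) → ℝ)
    (φ : EuclideanSpace ℝ (Fin d) → W → ℝ) (feat : Fin m → Ω → W)
    (particles : Ω → Fin n → EuclideanSpace ℝ (Fin d)) (ε M R : Fin d → ℝ) : Prop where
  hasLaw : ∀ l, HasLaw (feat l) μ P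
  indep : iIndepFun feat P
  particles_mem : ∀ᵐ ω ∂P, ∀ i, particles ω i ∈ X
  approx_fixed : ∀ᵐ ω ∂P, ∀ l j,
    |empiricalMean (particles ω) (steinOp p j fun y => φ y (feat l ω))| ≤ ε j / √(m : ℝ)
  isLUB : ∀ j, IsLUB {r : ℝ | ∃ x ∈ X, ∃ w, r = |steinOp p j (fun y => φ y w) x|} (M j)
  rademacher_integrable : ∀ j,
    Integrable (fun w : Fin m → W => empiricalRademacher (steinClass X p φ j) w)
      (Measure.pi fun _ => μ)
  rademacher_le : ∀ j, rademacherComplexity μ m (steinClass X p φ j) ≤ R j / √(m : ℝ)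

/-- The bounded weight functions `v : W → ℝᵈ` that represent `f` on `X` as
`f x = 𝔼_w [v(w)ᵀ 𝒜_x φ (x, w)]`. (`Fin d → ℝ` carries the sup norm.) -/
def representations {d : ℕ} {W : Type*} [MeasurableSpace W] (μ : Measure W)
    (X : Set (EuclideanSpace ℝ (Fin d))) (p : EuclideanSpace ℝ (Fin d) → ℝ)
    (φ : EuclideanSpace ℝ (Fin d) → W → ℝ) (f : EuclideanSpace ℝ (Fin d) → ℝ) :
    Set (W → Fin d → ℝ) :=
  {v | Measurable v ∧ (∃ B : ℝ, ∀ w, ‖v w‖ ≤ B) ∧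
    ∀ x ∈ X, f x = ∫ w, ∑ j, v w j * steinOp p j (fun y => φ y w) x ∂μ}

/-- Membership in `F_∞`. -/
def MemFInfty {d : ℕ} {W : Type*} [MeasurableSpace W] (μ : Measure W)
    (X : Set (EuclideanSpace ℝ (Fin d))) (p : EuclideanSpace ℝ (Fin d) → ℝ)
    (φ : EuclideanSpace ℝ (Fin d) → W → ℝ) (f : EuclideanSpace ℝ (Fin d) → ℝ) : Prop :=
  (representations μ X p φ f).Nonempty

/-- The norm of `F_∞`: `‖f‖² = inf_v ∑ⱼ sup_w |vⱼ(w)|²`, over the representations `v` of `f`. -/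
def fInftyNorm {d : ℕ} {W : Type*} [MeasurableSpace W] (μ : Measure W)
    (X : Set (EuclideanSpace ℝ (Fin d))) (p : EuclideanSpace ℝ (Fin d) → ℝ)
    (φ : EuclideanSpace ℝ (Fin d) → W → ℝ) (f : EuclideanSpace ℝ (Fin d) → ℝ) : ℝ :=
  √(sInf ((fun v : W → Fin d → ℝ => ∑ j, ⨆ w, |v w j| ^ 2) '' representations μ X p φ f))

end

open Set Filter Topology

/-! Fix a representation `v` of `f` and compare `f` with the random feature expansion `Y x = (1/m)
∑ₗ v(wₗ)ᵀ 𝒜ₓφ(x, wₗ)`. Three facts suffice. The target mean of `f` is zero, by Fubini and Stein's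
identity (`integral_steinOp_eq_zero`). The empirical mean of `Y` is `O(ε/√m)`: it is linear in the
residuals that the approximate fixed point condition controls (`abs_empiricalMean_features_le`).
Finally `f - Y` is `O(1/√m)` uniformly on `X` with high probability
(`measure_not_feature_deviation_le`); uniformity in `x` is what allows the particles to depend on
the features. The uniform bound combines symmetrization (`integral_iSup_deviation_le`), contraction
to remove the weights `v` (`rademacher_contraction`) and bounded differences
(`hasSubgaussianMGF_of_boundedDifferences`). The suprema run over an uncountable set; measurable
projection makes them almost everywhere measurable. Stein's identity needs neither regularity of `X`
nor continuity of the derivative of `g = p φ(·, w)`. Flattening `g` where `|g| ≤ η` gives a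
compactly supported function, whose derivative integrates to zero; then `η → 0`. The points with `g
= 0` and nonzero derivative are isolated on each line, hence form a null set. -/

/-! ### Measurable projection and suprema over uncountable families. -/

/-- Compactness: points outside `V` obeying ever more of the bounds share a limit, along a
subsequence, with their truncations `min (x k i) (N i)`. That limit lies in the full box, hence in
the open set `V`. -/
theorem exists_bounded_coord_subset_of_isOpen (N : ℕ → ℕ) {V : Set (ℕ → ℕ)} (hV : IsOpen V)
    (h : {x : ℕ → ℕ | ∀ i, x i ≤ N i} ⊆ V) : ∃ k, {x : ℕ → ℕ | ∀ i < k, x i ≤ N i} ⊆ V := by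
  by_contra! hcon
  simp only [not_subset] at hcon
  choose x hx hxV using hcon
  have hK : IsCompact {x : ℕ → ℕ | ∀ i, x i ≤ N i} := by
    have := isCompact_univ_pi (fun i => (Set.finite_Iic (N i)).isCompact)
    convert this using 1
    ext y; simp [Pi.le_def]
  obtain ⟨y, hy, φ, hφ, hlim⟩ := hK.tendsto_subseq (x := fun k i => min (x k i) (N i))
    (fun k i => min_le_right _ _)
  have hlim' : Tendsto (fun k => x (φ k)) atTop (𝓝 y) := by
    rw [tendsto_pi_nhds] at hlim ⊢
    intro i
    refine (hlim i).congr' ?_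
    filter_upwards [eventually_gt_atTop i] with k hk
    exact min_eq_left (hx (φ k) i (hk.trans_le (hφ.id_le k)))
  obtain ⟨k, hk⟩ := (hlim'.eventually (hV.mem_nhds (h hy))).exists
  exact hxV _ hk

/-- Analytic sets are inner regular with respect to compact sets. -/
theorem MeasureTheory.AnalyticSet.exists_isCompact_le_measure {α : Type*} [TopologicalSpace α]
    [TopologicalSpace.PseudoMetrizableSpace α] [MeasurableSpace α] [BorelSpace α]
    (μ : Measure α) [IsFiniteMeasure μ] {s : Set α} (hs : AnalyticSet s) {c : ENNReal}
    (hc : c < μ s) : ∃ K ⊆ s, IsCompact K ∧ c ≤ μ K := by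
  rw [AnalyticSet] at hs
  rcases hs with rfl | ⟨f, hf, rfl⟩
  · simp at hc
  let S : (ℕ → ℕ) → ℕ → Set (ℕ → ℕ) := fun g k => {x | ∀ i < k, x i ≤ g i}
  -- Bound one more coordinate without dropping to measure `c`. Continuity from below along monotone
  -- unions holds for the outer measure, so the images need not be measurable.
  have step : ∀ (k : ℕ) (g : ℕ → ℕ), c < μ (f '' S g k) →
      ∃ n, c < μ (f '' S (Function.update g k n) (k + 1)) := by
    intro k g hg
    have hmono : Monotone fun n => f '' S (Function.update g k n) (k + 1) := by
      intro a b hab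
      refine image_mono fun x hx i hi => (hx i hi).trans ?_
      rcases eq_or_ne i k with rfl | hik
      · simpa using hab
      · simp [hik]
    have hU : f '' S g k = ⋃ n, f '' S (Function.update g k n) (k + 1) := by
      rw [← image_iUnion]
      congr 1
      ext x
      simp only [S, mem_ofPred_eq, mem_iUnion]
      constructor
      · intro hx
        refine ⟨x k, fun i hi => ?_⟩
        rcases eq_or_ne i k with rfl | hik
        · simp
        · simpa [hik] using hx i (by omega)
      · rintro ⟨n, hn⟩ i hi
        simpa [hi.ne] using hn i (by omega)
    rw [hU, hmono.measure_iUnion] at hg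
    exact lt_iSup_iff.1 hg
  choose! next hnext using step
  -- Stage `k` changes only coordinate `k`, so the bounds stabilize to the diagonal sequence `N`.
  let st : ℕ → (ℕ → ℕ) := fun k =>
    Nat.rec (fun _ => 0) (fun k g => Function.update g k (next k g)) k
  have hst : ∀ k, c < μ (f '' S (st k) k) := by
    intro k
    induction k with
    | zero => simpa [S, image_univ] using hc
    | succ k ih => exact hnext k _ ih
  let N : ℕ → ℕ := fun i => st (i + 1) i
  have hN : ∀ k, ∀ i < k, st k i = N i := by
    intro k
    induction k with
    | zero => simp
    | succ k ih =>
      intro i hi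
      rcases eq_or_ne i k with rfl | hik
      · rfl
      · rw [← ih i (by omega)]
        change Function.update (st k) k (next k (st k)) i = _
        simp [hik]
  have hSN : ∀ k, c < μ (f '' S N k) := by
    intro k
    have : S N k = S (st k) k := by
      ext x
      exact forall₂_congr fun i hi => by rw [hN k i hi]
    rw [this]; exact hst k
  have hK : IsCompact {x : ℕ → ℕ | ∀ i, x i ≤ N i} := by
    have := isCompact_univ_pi (fun i => (Set.finite_Iic (N i)).isCompact)
    convert this using 1
    ext y; simp [Pi.le_def]
  refine ⟨f '' {x | ∀ i, x i ≤ N i}, image_subset_range _ _, hK.image hf, ?_⟩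
  -- Outer regularity would give an open set of measure below `c` around the compact image; it
  -- already contains the image of some finite stage, which has measure above `c`.
  by_contra! hlt
  obtain ⟨U, hKU, hU, hμU⟩ := Set.exists_isOpen_lt_of_lt _ c hlt
  obtain ⟨k, hk⟩ := exists_bounded_coord_subset_of_isOpen N (hU.preimage hf)
    (image_subset_iff.1 hKU)
  exact absurd (hSN k) (not_lt.2 ((measure_mono (image_subset_iff.2 hk)).trans hμU.le))

/-- Countably many compact subsets exhaust the outer measure of `s`. Their union and the measurable
hull of `s` enclose `s` and differ by a null set. -/
theorem MeasureTheory.AnalyticSet.nullMeasurableSet {α : Type*} [TopologicalSpace α]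
    [TopologicalSpace.PseudoMetrizableSpace α] [T2Space α] [MeasurableSpace α] [BorelSpace α]
    (μ : Measure α) [IsFiniteMeasure μ] {s : Set α} (hs : AnalyticSet s) :
    NullMeasurableSet s μ := by
  rcases eq_or_ne (μ s) 0 with h0 | h0
  · exact NullMeasurableSet.of_null h0
  obtain ⟨u, -, hu, hlim⟩ := exists_seq_strictMono_tendsto' (pos_iff_ne_zero.2 h0)
  choose K hKs hK hμK using fun n => hs.exists_isCompact_le_measure μ (hu n).2
  have hKm : MeasurableSet (⋃ n, K n) := MeasurableSet.iUnion fun n => (hK n).measurableSet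
  have hle : μ (toMeasurable μ s) ≤ μ (⋃ n, K n) := by
    rw [measure_toMeasurable]
    exact le_of_tendsto' hlim fun n => (hμK n).trans (measure_mono (subset_iUnion K n))
  have hsub : (⋃ n, K n) ⊆ s := iUnion_subset hKs
  refine ⟨⋃ n, K n, hKm, ?_⟩
  have h1 := ae_eq_of_subset_of_measure_ge (hsub.trans (subset_toMeasurable μ s)) hle
    hKm.nullMeasurableSet (measure_ne_top _ _)
  exact ((subset_toMeasurable μ s).eventuallyLE.trans h1.symm.le).antisymm hsub.eventuallyLE

/-- A measurable subset of `X × W` is pulled back from a measurable subset of `X × 2^ℕ`. -/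
theorem MeasurableSet.exists_cantor_preimage {X W : Type*} [MeasurableSpace X] [MeasurableSpace W]
    {E : Set (X × W)} (hE : MeasurableSet E) :
    ∃ ι : W → ℕ → Bool, Measurable ι ∧ ∃ E' : Set (X × (ℕ → Bool)), MeasurableSet E' ∧
      E = Prod.map id ι ⁻¹' E' := by
  classical
  induction E, hE using MeasurableSpace.induction_on_inter generateFrom_prod.symm isPiSystem_prod
  with
  | empty => exact ⟨fun _ _ => false, measurable_const, ∅, MeasurableSet.empty, by simp⟩
  | basic t ht =>
    obtain ⟨A, hA, B, hB, rfl⟩ := ht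
    refine ⟨fun w _ => decide (w ∈ B), ?_, A ×ˢ {c | c 0 = true}, ?_, ?_⟩
    · exact measurable_pi_lambda _ fun _ => measurable_to_bool (by
        convert (show MeasurableSet B from hB) using 1
        ext w; simp)
    · exact (show MeasurableSet A from hA).prod
        (measurableSet_eq_fun (measurable_pi_apply 0) measurable_const)
    · ext ⟨x, w⟩; simp
  | compl t ht ih =>
    obtain ⟨ι, hι, E', hE', rfl⟩ := ih
    exact ⟨ι, hι, E'ᶜ, hE'.compl, rfl⟩
  | iUnion f hd hf ih =>
    choose ι hι E' hE' h using ih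
    -- The countably many codes are interleaved into one sequence through the pairing of `ℕ × ℕ`
    -- with `ℕ`; `pr k` extracts the `k`-th.
    let pr : ℕ → (ℕ → Bool) → (ℕ → Bool) := fun k c n => c (Nat.pair k n)
    have hpr : ∀ k, Measurable (pr k) := fun k =>
      measurable_pi_lambda _ fun n => measurable_pi_apply _
    refine ⟨fun w n => ι n.unpair.1 w n.unpair.2, ?_, ⋃ k, Prod.map id (pr k) ⁻¹' E' k, ?_, ?_⟩
    · exact measurable_pi_lambda _ fun n => (measurable_pi_apply _).comp (hι _)
    · exact MeasurableSet.iUnion fun k => (measurable_id.prodMap (hpr k)) (hE' k)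
    · rw [preimage_iUnion]
      refine iUnion_congr fun k => ?_
      rw [h k]
      ext ⟨x, w⟩
      simp [pr]

/-- Measurable projection along a standard Borel space. -/
theorem MeasurableSet.nullMeasurableSet_image_snd {X W : Type*} [MeasurableSpace X]
    [StandardBorelSpace X] [MeasurableSpace W] (ν : Measure W) [IsFiniteMeasure ν]
    {E : Set (X × W)} (hE : MeasurableSet E) : NullMeasurableSet (Prod.snd '' E) ν := by
  -- `W` is arbitrary, so the projection is carried out in `X × 2^ℕ`, where it is analytic, and
  -- pulled back along `ι`.
  obtain ⟨ι, hι, E', hE', rfl⟩ := hE.exists_cantor_preimage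
  have h1 : AnalyticSet (Prod.snd '' E') := hE'.analyticSet_image measurable_snd
  have h2 := h1.nullMeasurableSet (ν.map ι)
  have h3 : Prod.snd '' (Prod.map id ι ⁻¹' E' : Set (X × W)) = ι ⁻¹' (Prod.snd '' E') := by
    ext w
    simp
  rw [h3]
  exact h2.preimage (hι.quasiMeasurePreserving ν)

/-- The supremum over a standard Borel parameter of a jointly measurable function is
almost everywhere measurable. -/
theorem Measurable.aemeasurable_iSup_param {X W : Type*} [MeasurableSpace X]
    [StandardBorelSpace X] [Nonempty X] [MeasurableSpace W] (ν : Measure W) [IsFiniteMeasure ν]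
    {F : X → W → ℝ} (hF : Measurable (Function.uncurry F))
    (hb : ∀ w, BddAbove (range fun x => F x w)) :
    AEMeasurable (fun w => ⨆ x, F x w) ν := by
  refine NullMeasurable.aemeasurable ?_
  refine fun s hs => ?_
  have key : ∀ c : ℝ, NullMeasurableSet ((fun w => ⨆ x, F x w) ⁻¹' Ioi c) ν := by
    intro c
    -- The superlevel set of a supremum is the projection of a superlevel set of `F`.
    have h := (hF (measurableSet_Ioi (a := c))).nullMeasurableSet_image_snd ν
    convert h using 1
    ext w
    simp [lt_ciSup_iff (hb w), Function.uncurry]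
  have hm : @Measurable (NullMeasurableSpace W ν) ℝ _ (borel ℝ) (fun w => ⨆ x, F x w) :=
    measurable_of_Ioi key
  rw [BorelSpace.measurable_eq (α := ℝ)] at hs
  exact hm hs

/-! ### The bounded differences inequality. -/

/-- Tensorization of sub-Gaussian bounds: if the slices of `H` are uniformly sub-Gaussian and `H`
varies by at most `c` in the first coordinate, then `H` is sub-Gaussian. -/
theorem hasSubgaussianMGF_prod_of_slices {A S : Type*} [MeasurableSpace A] [MeasurableSpace S]
    (μ : Measure A) [IsProbabilityMeasure μ] (ν : Measure S) [IsProbabilityMeasure ν]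
    {H : A × S → ℝ} (hH : AEMeasurable H (μ.prod ν)) {B : ℝ} (hB : ∀ z, |H z| ≤ B)
    {c C : NNReal} (hc : ∀ a b s, |H (a, s) - H (b, s)| ≤ c)
    (hslice : ∀ a, AEMeasurable (fun s => H (a, s)) ν →
      HasSubgaussianMGF (fun s => H (a, s) - ∫ s, H (a, s) ∂ν) C ν) :
    HasSubgaussianMGF (fun z => H z - ∫ z, H z ∂(μ.prod ν)) (C + c ^ 2) (μ.prod ν) := by
  have hHs : AEStronglyMeasurable H (μ.prod ν) := hH.aestronglyMeasurable
  have hHi : Integrable H (μ.prod ν) :=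
    Integrable.of_bound hHs B (ae_of_all _ fun z => by simpa using hB z)
  set G : A → ℝ := fun a => ∫ s, H (a, s) ∂ν with hG
  have hGm : AEStronglyMeasurable G μ := hHs.integral_prod_right'
  have hgood : ∀ᵐ a ∂μ, AEMeasurable (fun s => H (a, s)) ν := by
    filter_upwards [hHs.prodMk_left] with a ha using ha.aemeasurable
  have hint : ∀ a, AEMeasurable (fun s => H (a, s)) ν → Integrable (fun s => H (a, s)) ν :=
    fun a ha => Integrable.of_bound ha.aestronglyMeasurable B
      (ae_of_all _ fun z => by simpa using hB _)
  -- Only almost every slice is known to be measurable, so the reference point is taken among the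
  -- good ones. The slice means then lie within `c` of `G a₀`, and Hoeffding's lemma on an interval
  -- of length `2c` gives the parameter `c ^ 2`.
  obtain ⟨a₀, ha₀⟩ := hgood.exists
  have hGIcc : ∀ᵐ a ∂μ, G a ∈ Icc (G a₀ - c) (G a₀ + c) := by
    filter_upwards [hgood] with a ha
    have : |G a - G a₀| ≤ c := by
      rw [hG]
      simp only
      rw [← integral_sub (hint a ha) (hint a₀ ha₀)]
      have := norm_integral_le_of_norm_le_const (μ := ν) (f := fun s => H (a, s) - H (a₀, s))
        (C := c) (ae_of_all _ fun s => hc a a₀ s)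
      simpa using this
    rw [abs_le] at this
    constructor <;> linarith
  have hGsub := hasSubgaussianMGF_of_mem_Icc hGm.aemeasurable hGIcc
  have hEG : ∫ z, H z ∂(μ.prod ν) = μ[G] := integral_prod _ hHi
  have hpar : ((‖(G a₀ + c) - (G a₀ - c)‖₊ / 2) ^ 2 : NNReal) = c ^ 2 := by
    congr 1
    ext
    simp only [NNReal.coe_div, coe_nnnorm, Real.norm_eq_abs, NNReal.coe_ofNat]
    rw [abs_of_nonneg (by linarith [c.2] : (0:ℝ) ≤ (G a₀ + c) - (G a₀ - c))]
    ring
  rw [hpar] at hGsub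
  rw [hEG]
  have hexp : ∀ t : ℝ, Integrable (fun z => Real.exp (t * (H z - μ[G]))) (μ.prod ν) := by
    intro t
    refine Integrable.of_bound (C := Real.exp (|t| * (B + |μ[G]|))) ?_ (ae_of_all _ fun z => ?_)
    · exact (Real.measurable_exp.comp_aemeasurable
        ((hH.sub_const _).const_mul t)).aestronglyMeasurable
    · rw [Real.norm_eq_abs, Real.abs_exp, Real.exp_le_exp]
      refine (le_abs_self _).trans ?_
      rw [abs_mul]
      gcongr
      exact (abs_sub _ _).trans (by gcongr; exact hB z)
  refine ⟨hexp, fun t => ?_⟩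
  rw [mgf, integral_prod _ (hexp t)]
  calc ∫ a, ∫ s, Real.exp (t * (H (a, s) - μ[G])) ∂ν ∂μ
      ≤ ∫ a, Real.exp (C * t ^ 2 / 2) * Real.exp (t * (G a - μ[G])) ∂μ := by
        refine integral_mono_ae (hexp t).integral_prod_left
          ((hGsub.integrable_exp_mul t).const_mul _) ?_
        filter_upwards [hgood] with a ha
        -- The deviation splits as `(H - G a) + (G a - μ[G])`, so the exponential factors.
        have h1 := (hslice a ha).mgf_le t
        have h2 : ∫ s, Real.exp (t * (H (a, s) - μ[G])) ∂ν =
            mgf (fun s => H (a, s) - ∫ s, H (a, s) ∂ν) ν t * Real.exp (t * (G a - μ[G])) := by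
          rw [mgf, ← integral_mul_const]
          congr 1 with s
          rw [← Real.exp_add]
          congr 1
          simp only [hG]
          ring
        rw [h2]
        gcongr
    _ ≤ Real.exp (C * t ^ 2 / 2) * Real.exp ((c ^ 2 : NNReal) * t ^ 2 / 2) := by
        rw [integral_const_mul]
        gcongr
        exact hGsub.mgf_le t
    _ = Real.exp ((C + c ^ 2 : NNReal) * t ^ 2 / 2) := by
        rw [← Real.exp_add]
        push_cast
        ring_nf

/-- The bounded differences inequality (McDiarmid), for almost everywhere measurable functions. -/
theorem hasSubgaussianMGF_of_boundedDifferences {W : Type*} [MeasurableSpace W] (μ : Measure W)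
    [IsProbabilityMeasure μ] (c : NNReal) {B : ℝ} (m : ℕ) {F : (Fin m → W) → ℝ}
    (hF : AEMeasurable F (Measure.pi fun _ => μ)) (hB : ∀ w, |F w| ≤ B)
    (hc : ∀ w i a, |F (Function.update w i a) - F w| ≤ c) :
    HasSubgaussianMGF (fun w => F w - ∫ w, F w ∂(Measure.pi fun _ => μ)) (m * c ^ 2)
      (Measure.pi fun _ : Fin m => μ) := by
  induction m with
  | zero =>
    have : (fun w => F w - ∫ w, F w ∂(Measure.pi fun _ => μ)) = fun _ => 0 := by
      ext w
      have : F = fun _ => F w := funext fun w' => by rw [Subsingleton.elim w' w]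
      rw [this]
      simp
    rw [this]
    simp
  | succ m ih =>
    -- Induction splits off the first coordinate; the slices are functions of the remaining `m`
    -- coordinates with the same differences.
    have he := measurePreserving_piFinSuccAbove (fun _ : Fin (m + 1) => μ) 0
    set e := MeasurableEquiv.piFinSuccAbove (fun _ : Fin (m + 1) => W) 0
    let H : W × (Fin m → W) → ℝ := fun z => F (Fin.cons z.1 z.2)
    have hes : ∀ z, e.symm z = Fin.cons z.1 z.2 := by
      intro z
      simp [e, MeasurableEquiv.piFinSuccAbove, Fin.insertNthEquiv]
    have hHF : H = F ∘ e.symm := by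
      ext z
      simp [H, hes]
    have hFH : F = H ∘ e := by
      rw [hHF]; ext w; simp
    have hH : AEMeasurable H (μ.prod (Measure.pi fun _ : Fin m => μ)) := by
      rw [hHF]
      exact hF.comp_quasiMeasurePreserving (he.symm e).quasiMeasurePreserving
    have hmain : HasSubgaussianMGF
        (fun z => H z - ∫ z, H z ∂(μ.prod (Measure.pi fun _ : Fin m => μ)))
        (m * c ^ 2 + c ^ 2) (μ.prod (Measure.pi fun _ : Fin m => μ)) := by
      refine hasSubgaussianMGF_prod_of_slices μ _ hH (B := B) (fun z => hB _) ?_ ?_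
      · intro a b s
        have := hc (Fin.cons b s) 0 a
        rwa [Fin.update_cons_zero] at this
      · intro a ha
        refine ih ha (fun w => hB _) fun w i x => ?_
        have := hc (Fin.cons a w) i.succ x
        rwa [← Fin.cons_update] at this
    have hint : ∫ w, F w ∂(Measure.pi fun _ : Fin (m + 1) => μ) =
        ∫ z, H z ∂(μ.prod (Measure.pi fun _ : Fin m => μ)) := by
      rw [← he.integral_comp e.measurableEmbedding]
      exact integral_congr_ae (ae_of_all _ fun w => congrFun hFH w)
    rw [hint]
    have h2 : HasSubgaussianMGF
        ((fun z => H z - ∫ z, H z ∂(μ.prod (Measure.pi fun _ : Fin m => μ))) ∘ e)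
        (m * c ^ 2 + c ^ 2) (Measure.pi fun _ : Fin (m + 1) => μ) :=
      HasSubgaussianMGF.of_map he.measurable.aemeasurable (by rw [he.map_eq]; exact hmain)
    convert h2 using 1
    · ext w
      simp only [Function.comp]
      rw [congrFun hFH w]
      rfl
    · push_cast; ring

/-! ### Rademacher averages: contraction and symmetrization. -/

theorem abs_average_le {m : ℕ} (hm : 0 < m) {y : Fin m → ℝ} {B : ℝ} (h : ∀ l, |y l| ≤ B) :
    |(1 / (m : ℝ)) * ∑ l, y l| ≤ B := by
  have hm' : (0 : ℝ) < m := by exact_mod_cast hm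
  rw [abs_mul, abs_of_nonneg (by positivity), one_div_mul_eq_div, div_le_iff₀ hm']
  calc |∑ l, y l| ≤ ∑ l, |y l| := Finset.abs_sum_le_sum_abs _ _
    _ ≤ ∑ _l : Fin m, B := Finset.sum_le_sum fun l _ => h l
    _ = B * m := by simp [mul_comm]

theorem abs_sign_mul (s : ℤˣ) (y : ℝ) : |((s : ℤ) : ℝ) * y| = |y| := by
  rcases Int.units_eq_one_or s with rfl | rfl <;> simp

theorem bddAbove_range_of_abs_le {ι : Sort*} {u : ι → ℝ} {B : ℝ} (h : ∀ i, |u i| ≤ B) :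
    BddAbove (range u) := ⟨B, by rintro _ ⟨i, rfl⟩; exact (le_abs_self _).trans (h i)⟩

theorem abs_ciSup_le {ι : Sort*} [Nonempty ι] {u : ι → ℝ} {B : ℝ} (h : ∀ i, |u i| ≤ B) :
    |⨆ i, u i| ≤ B := by
  obtain ⟨i⟩ := ‹Nonempty ι›
  have : Nonempty ι := ⟨i⟩
  rw [abs_le]
  exact ⟨(abs_le.1 (h i)).1.trans (le_ciSup (bddAbove_range_of_abs_le h) i),
    ciSup_le fun i => (abs_le.1 (h i)).2⟩

theorem sum_sign_reparam {m : ℕ} (Φ : (Fin m → ℤˣ) → ℝ) (τ : Fin m → ℤˣ) :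
    ∑ σ, Φ (σ * τ) = ∑ σ, Φ σ :=
  Equiv.sum_comp (Equiv.mulRight τ) Φ

/-- The contraction principle for Rademacher averages with bounded weights. -/
theorem rademacher_contraction {ι : Type*} [Nonempty ι] {m : ℕ} (hm : 0 < m)
    {g : ι → Fin m → ℝ} {B : ℝ} (hg : ∀ i l, |g i l| ≤ B) {V : ℝ} (hV : 0 ≤ V) {a : Fin m → ℝ}
    (ha : ∀ l, |a l| ≤ V) :
    ∑ σ : Fin m → ℤˣ, ⨆ i, (1 / (m : ℝ)) * ∑ l, ((σ l : ℤ) : ℝ) * (a l * g i l) ≤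
      V * ∑ σ : Fin m → ℤˣ, ⨆ i, (1 / (m : ℝ)) * ∑ l, ((σ l : ℤ) : ℝ) * g i l := by
  let T : (Fin m → ℤˣ) → ι → (Fin m → ℝ) → ℝ := fun σ i b =>
    (1 / (m : ℝ)) * ∑ l, ((σ l : ℤ) : ℝ) * (b l * g i l)
  have hB : 0 ≤ B := (abs_nonneg _).trans (hg (Classical.arbitrary ι) ⟨0, hm⟩)
  have hbdd : ∀ σ b, BddAbove (range fun i => T σ i b) := fun σ b =>
    bddAbove_range_of_abs_le (B := (∑ l, |b l|) * B) fun i => abs_average_le hm fun l => by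
      rw [abs_sign_mul, abs_mul]
      exact mul_le_mul (Finset.single_le_sum (fun l _ => abs_nonneg (b l)) (Finset.mem_univ l))
        (hg i l) (abs_nonneg _) (Finset.sum_nonneg fun l _ => abs_nonneg _)
  have hT : ∀ σ i (s t : ℝ) b b', T σ i (s • b + t • b') = s * T σ i b + t * T σ i b' := by
    intro σ i s t b b'
    simp only [T, Finset.mul_sum, ← Finset.sum_add_distrib, Pi.add_apply, Pi.smul_apply,
      smul_eq_mul]
    exact Finset.sum_congr rfl fun l _ => by ring
  -- As a sum of suprema of linear functions, the average is convex in the weights, so over the cube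
  -- `[-V, V]^m` it is dominated by its value at a vertex.
  have hconv : ConvexOn ℝ univ fun b => ∑ σ, ⨆ i, T σ i b := by
    refine ⟨convex_univ, fun b _ b' _ s t hs ht _ => ?_⟩
    simp only [smul_eq_mul, Finset.mul_sum, ← Finset.sum_add_distrib]
    refine Finset.sum_le_sum fun σ _ => ciSup_le fun i => ?_
    rw [hT]
    gcongr
    · exact le_ciSup (hbdd σ b) i
    · exact le_ciSup (hbdd σ b') i
  have hmem : a ∈ convexHull ℝ (univ.pi fun _ : Fin m => ({-V, V} : Set ℝ)) := by
    rw [convexHull_pi]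
    intro l _
    rw [convexHull_pair, segment_eq_Icc (by linarith)]
    exact abs_le.1 (ha l)
  obtain ⟨y, hy, hle⟩ := hconv.exists_ge_of_mem_convexHull (subset_univ _) hmem
  have hτ : ∀ l, ∃ τ : ℤˣ, y l = V * ((τ : ℤ) : ℝ) := by
    intro l
    rcases hy l (mem_univ _) with h | h
    · exact ⟨-1, by rw [h]; simp⟩
    · exact ⟨1, by rw [mem_singleton_iff.1 h]; simp⟩
  choose τ hτ using hτ
  refine hle.trans_eq ?_
  -- At a vertex the weights are `V` times signs, and the signs are absorbed by permuting the sign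
  -- vectors.
  rw [← sum_sign_reparam _ τ, Finset.mul_sum]
  refine Finset.sum_congr rfl fun σ _ => ?_
  rw [Real.mul_iSup_of_nonneg hV]
  congr 1 with i
  simp only [T, Finset.mul_sum]
  refine Finset.sum_congr rfl fun l _ => ?_
  rw [hτ]
  rcases Int.units_eq_one_or (τ l) with h | h <;> simp [h] <;> ring

/-- Symmetrization: the expected one-sided uniform deviation of empirical means is at most twice
any integrable upper bound of the empirical Rademacher averages. -/
theorem integral_iSup_deviation_le {T W : Type*} [MeasurableSpace T] [StandardBorelSpace T]
    [Nonempty T] [MeasurableSpace W] (μ : Measure W) [IsProbabilityMeasure μ] {m : ℕ} (hm : 0 < m)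
    {h : T → W → ℝ} (hh : Measurable (Function.uncurry h)) {B : ℝ} (hB : ∀ t w, |h t w| ≤ B)
    {Q : (Fin m → W) → ℝ} (hQi : Integrable Q (Measure.pi fun _ => μ))
    (hQ : ∀ w, (1 / (2 : ℝ) ^ m) * ∑ σ : Fin m → ℤˣ,
      ⨆ t, (1 / (m : ℝ)) * ∑ l, ((σ l : ℤ) : ℝ) * h t (w l) ≤ Q w) :
    ∫ w : Fin m → W, ⨆ t, (∫ x, h t x ∂μ - (1 / (m : ℝ)) * ∑ l, h t (w l)) ∂(Measure.pi fun _ => μ) ≤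
      2 * ∫ w, Q w ∂(Measure.pi fun _ => μ) := by
  -- Each `z l` pairs a sample point with a ghost point; a sign `-1` amounts to exchanging the two.
  let D : (Fin m → ℤˣ) → T → (Fin m → W × W) → ℝ := fun σ t z =>
    (1 / (m : ℝ)) * ∑ l, ((σ l : ℤ) : ℝ) * (h t (z l).2 - h t (z l).1)
  let Φ : (Fin m → ℤˣ) → (Fin m → W × W) → ℝ := fun σ z => ⨆ t, D σ t z
  let π := Measure.pi fun _ : Fin m => μ.prod μ
  have hDb : ∀ σ t z, |D σ t z| ≤ 2 * B := fun σ t z => abs_average_le hm fun l => by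
    rw [abs_sign_mul]
    exact (abs_sub _ _).trans (by linarith [hB t (z l).1, hB t (z l).2])
  have hΦb : ∀ σ z, |Φ σ z| ≤ 2 * B := fun σ z => abs_ciSup_le fun t => hDb σ t z
  have hDm : ∀ σ, Measurable (Function.uncurry (D σ)) := by
    intro σ
    change Measurable fun q : T × (Fin m → W × W) =>
      (1 / (m : ℝ)) * ∑ l, ((σ l : ℤ) : ℝ) * (h q.1 (q.2 l).2 - h q.1 (q.2 l).1)
    refine Measurable.const_mul (Finset.measurable_fun_sum (Finset.univ : Finset (Fin m)) fun l _ => ?_) _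
    refine Measurable.const_mul (Measurable.sub ?_ ?_) _
    · exact hh.comp (measurable_fst.prodMk
        (measurable_snd.comp ((measurable_pi_apply l).comp measurable_snd)))
    · exact hh.comp (measurable_fst.prodMk
        (measurable_fst.comp ((measurable_pi_apply l).comp measurable_snd)))
  have hΦm : ∀ σ, AEMeasurable (Φ σ) π := fun σ =>
    (hDm σ).aemeasurable_iSup_param π fun z => bddAbove_range_of_abs_le fun t => hDb σ t z
  have hΦi : ∀ σ, Integrable (Φ σ) π := fun σ =>
    Integrable.of_bound (hΦm σ).aestronglyMeasurable (2 * B) (ae_of_all _ (hΦb σ))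
  have hh1 : ∀ t, Measurable (h t) := fun t => hh.comp measurable_prodMk_left
  -- the swapped differences have the same law
  have hswap : ∀ σ, ∫ z, Φ σ z ∂π = ∫ z, Φ 1 z ∂π := by
    intro σ
    let f : Fin m → W × W → W × W := fun l => if σ l = 1 then id else Prod.swap
    have hf : ∀ l, MeasurePreserving (f l) (μ.prod μ) (μ.prod μ) := by
      intro l
      by_cases hl : σ l = 1
      · simp only [f, hl, if_true]; exact MeasurePreserving.id _
      · simp only [f, hl, if_false]; exact Measure.measurePreserving_swap
    have hS := measurePreserving_pi (fun _ : Fin m => μ.prod μ) (fun _ => μ.prod μ) hf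
    have hcomp : Φ σ = fun z => Φ 1 fun l => f l (z l) := by
      ext z
      simp only [Φ, D]
      congr 1 with t
      congr 1
      refine Finset.sum_congr rfl fun l _ => ?_
      rcases Int.units_eq_one_or (σ l) with hl | hl
      · simp [f, hl]
      · simp [f, hl]
    rw [hcomp]
    have := integral_map hS.measurable.aemeasurable (f := Φ 1)
      (by rw [hS.map_eq]; exact (hΦm 1).aestronglyMeasurable)
    rw [hS.map_eq] at this
    exact this.symm
  -- first step: introduce a ghost sample
  have hghost : ∫ w : Fin m → W, ⨆ t, (∫ x, h t x ∂μ - (1 / (m : ℝ)) * ∑ l, h t (w l))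
      ∂(Measure.pi fun _ => μ) ≤ ∫ z, Φ 1 z ∂π := by
    have he := measurePreserving_arrowProdEquivProdArrow W W (Fin m) (fun _ => μ) (fun _ => μ)
    set e := MeasurableEquiv.arrowProdEquivProdArrow W W (Fin m)
    have hes : ∀ w w' l, e.symm (w, w') l = (w l, w' l) := fun w w' l => rfl
    have hi : Integrable (fun y => Φ 1 (e.symm y))
        ((Measure.pi fun _ : Fin m => μ).prod (Measure.pi fun _ : Fin m => μ)) :=
      ((he.symm e).integrable_comp_emb e.symm.measurableEmbedding).2 (hΦi 1)
    have h1 : ∫ z, Φ 1 z ∂π = ∫ w, ∫ w', Φ 1 (e.symm (w, w'))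
        ∂(Measure.pi fun _ : Fin m => μ) ∂(Measure.pi fun _ : Fin m => μ) := by
      rw [← (he.symm e).integral_comp', integral_prod _ hi]
    rw [h1]
    have hZb : ∀ t (w : Fin m → W),
        |∫ x, h t x ∂μ - (1 / (m : ℝ)) * ∑ l, h t (w l)| ≤ B + B := by
      intro t w
      refine (abs_sub _ _).trans (add_le_add ?_ (abs_average_le hm fun l => hB t _))
      have := norm_integral_le_of_norm_le_const (μ := μ) (f := h t) (C := B)
        (ae_of_all _ fun x => hB t x)
      simpa using this
    have hZm : Measurable (Function.uncurry fun t (w : Fin m → W) =>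
        ∫ x, h t x ∂μ - (1 / (m : ℝ)) * ∑ l, h t (w l)) := by
      change Measurable fun q : T × (Fin m → W) =>
        ∫ x, h q.1 x ∂μ - (1 / (m : ℝ)) * ∑ l, h q.1 (q.2 l)
      refine Measurable.sub ?_ (Measurable.const_mul (Finset.measurable_fun_sum (Finset.univ : Finset (Fin m)) fun l _ => ?_) _)
      · have := (hh.stronglyMeasurable.integral_prod_right (ν := μ)).measurable
        exact this.comp measurable_fst
      · exact hh.comp (measurable_fst.prodMk ((measurable_pi_apply l).comp measurable_snd))
    refine integral_mono_ae ?_ hi.integral_prod_left ?_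
    · exact Integrable.of_bound (hZm.aemeasurable_iSup_param _ fun w =>
        bddAbove_range_of_abs_le fun t => hZb t w).aestronglyMeasurable (B + B)
        (ae_of_all _ fun w => abs_ciSup_le fun t => hZb t w)
    · filter_upwards [hi.prod_right_ae] with w hw
      refine ciSup_le fun t => ?_
      -- The deviation is the mean of `D 1 t` over the ghost sample, and a supremum of means is at
      -- most the mean of the supremum.
      have h2 : ∫ x, h t x ∂μ - (1 / (m : ℝ)) * ∑ l, h t (w l) =
          ∫ w', D 1 t (e.symm (w, w')) ∂(Measure.pi fun _ : Fin m => μ) := by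
        have hin : ∀ l, Integrable (fun w' : Fin m → W => h t (w' l))
            (Measure.pi fun _ : Fin m => μ) := fun l =>
          Integrable.of_bound ((hh1 t).comp (measurable_pi_apply l)).aestronglyMeasurable B
            (ae_of_all _ fun w' => hB t _)
        simp only [D, hes, Pi.one_apply, Units.val_one, Int.cast_one, one_mul]
        have hin' : ∀ l ∈ (Finset.univ : Finset (Fin m)), Integrable
            (fun w' : Fin m → W => h t (w' l) - h t (w l)) (Measure.pi fun _ : Fin m => μ) :=
          fun l _ => (hin l).sub (integrable_const _)
        rw [integral_const_mul, integral_finsetSum _ hin']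
        have : ∀ l, ∫ w' : Fin m → W, (h t (w' l) - h t (w l)) ∂(Measure.pi fun _ : Fin m => μ) =
            ∫ x, h t x ∂μ - h t (w l) := by
          intro l
          rw [integral_sub (hin l) (integrable_const _),
            integral_comp_eval (μ := fun _ : Fin m => μ) (hh1 t).aestronglyMeasurable]
          simp
        simp only [this, Finset.sum_sub_distrib, Finset.sum_const, Finset.card_univ,
          Fintype.card_fin, nsmul_eq_mul]
        have : (m : ℝ) ≠ 0 := by exact_mod_cast hm.ne'
        field_simp
      rw [h2]
      exact integral_mono (Integrable.of_bound ((hDm 1).comp (measurable_const.prodMk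
        (e.symm.measurable.comp measurable_prodMk_left))).aestronglyMeasurable (2 * B)
        (ae_of_all _ fun w' => hDb 1 t _)) hw fun w' =>
          le_ciSup (bddAbove_range_of_abs_le fun t => hDb 1 t _) t
  -- second step: average over the signs
  refine hghost.trans ?_
  have hfst := measurePreserving_pi (fun _ : Fin m => μ.prod μ) (fun _ => μ)
    (fun _ => measurePreserving_fst)
  have hsnd := measurePreserving_pi (fun _ : Fin m => μ.prod μ) (fun _ => μ)
    (fun _ => measurePreserving_snd)
  have hQ1 : Integrable (fun z : Fin m → W × W => Q fun l => (z l).1) π :=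
    hfst.integrable_comp_of_integrable hQi
  have hQ2 : Integrable (fun z : Fin m → W × W => Q fun l => (z l).2) π :=
    hsnd.integrable_comp_of_integrable hQi
  have hQe1 : ∫ z, Q (fun l => (z l).1) ∂π = ∫ w, Q w ∂(Measure.pi fun _ => μ) := by
    have := integral_map hfst.measurable.aemeasurable (f := Q)
      (by rw [hfst.map_eq]; exact hQi.1)
    rw [hfst.map_eq] at this
    exact this.symm
  have hQe2 : ∫ z, Q (fun l => (z l).2) ∂π = ∫ w, Q w ∂(Measure.pi fun _ => μ) := by
    have := integral_map hsnd.measurable.aemeasurable (f := Q)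
      (by rw [hsnd.map_eq]; exact hQi.1)
    rw [hsnd.map_eq] at this
    exact this.symm
  have hcard : ((Finset.univ : Finset (Fin m → ℤˣ)).card : ℝ) = 2 ^ m := by
    simp [Finset.card_univ]
  calc ∫ z, Φ 1 z ∂π = ∫ z, (1 / (2 : ℝ) ^ m) * ∑ σ : Fin m → ℤˣ, Φ σ z ∂π := by
        rw [integral_const_mul, integral_finsetSum _ fun σ _ => hΦi σ,
          Finset.sum_congr rfl fun σ _ => hswap σ, Finset.sum_const, nsmul_eq_mul, hcard]
        field_simp
    _ ≤ ∫ z, (Q (fun l => (z l).2) + Q fun l => (z l).1) ∂π := by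
        refine integral_mono ((integrable_finsetSum _ fun σ _ => hΦi σ).const_mul _)
          (hQ2.add hQ1) fun z => ?_
        have hsb : ∀ (σ : Fin m → ℤˣ) (w : Fin m → W), BddAbove (range fun t =>
            (1 / (m : ℝ)) * ∑ l, ((σ l : ℤ) : ℝ) * h t (w l)) := fun σ w =>
          bddAbove_range_of_abs_le fun t => abs_average_le hm fun l => by
            rw [abs_sign_mul]; exact hB t _
        -- The minus sign of the first sample goes into `σ * -1`, which runs over all sign vectors
        -- as `σ` does; the two halves produce the factor 2.
        have h1 : ∀ σ, Φ σ z ≤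
            (⨆ t, (1 / (m : ℝ)) * ∑ l, ((σ l : ℤ) : ℝ) * h t (z l).2) +
            ⨆ t, (1 / (m : ℝ)) * ∑ l, (((σ * -1) l : ℤˣ) : ℤ) * h t (z l).1 := by
          intro σ
          refine ciSup_le fun t => ?_
          refine le_trans (le_of_eq ?_) (add_le_add (le_ciSup (hsb σ fun l => (z l).2) t)
            (le_ciSup (hsb (σ * -1) fun l => (z l).1) t))
          simp only [D, ← mul_add, ← Finset.sum_add_distrib]
          congr 1
          refine Finset.sum_congr rfl fun l _ => ?_
          simp
          ring
        calc (1 / (2 : ℝ) ^ m) * ∑ σ : Fin m → ℤˣ, Φ σ z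
            ≤ (1 / (2 : ℝ) ^ m) * ∑ σ : Fin m → ℤˣ,
              ((⨆ t, (1 / (m : ℝ)) * ∑ l, ((σ l : ℤ) : ℝ) * h t (z l).2) +
              ⨆ t, (1 / (m : ℝ)) * ∑ l, (((σ * -1) l : ℤˣ) : ℤ) * h t (z l).1) := by
              gcongr with σ
              exact h1 σ
          _ ≤ _ := by
              rw [Finset.sum_add_distrib, mul_add, sum_sign_reparam
                (fun σ => ⨆ t, (1 / (m : ℝ)) * ∑ l, ((σ l : ℤ) : ℝ) * h t (z l).1) (-1)]
              exact add_le_add (hQ fun l => (z l).2) (hQ fun l => (z l).1)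
    _ = 2 * ∫ w, Q w ∂(Measure.pi fun _ => μ) := by
        rw [integral_add hQ2 hQ1, hQe1, hQe2]; ring

/-! ### The divergence theorem for functions vanishing at the boundary. -/

/-- Such a set is discrete in its subspace topology, and a separable discrete space is countable. -/
theorem Set.countable_of_forall_eventually_notMem {A : Set ℝ}
    (h : ∀ t ∈ A, ∀ᶠ s in 𝓝[≠] t, s ∉ A) : A.Countable := by
  have : DiscreteTopology A := by
    rw [discreteTopology_subtype_iff]
    intro t ht
    rw [← disjoint_iff, disjoint_principal_right]
    exact h t ht
  exact TopologicalSpace.separableSpace_iff_countable.1 inferInstance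

/-- The points of the zero set of `g` at which a line derivative of `g` exists and does not
vanish form a null set. -/
theorem measure_zeros_lineDeriv_ne_zero {E : Type*} [NormedAddCommGroup E] [NormedSpace ℝ E]
    [FiniteDimensional ℝ E] [MeasurableSpace E] [BorelSpace E] (μ : Measure E)
    [μ.IsAddHaarMeasure] {S : Set E} (hS : MeasurableSet S) {g g' : E → ℝ} {v : E}
    (h0 : ∀ x ∈ S, g x = 0) (hd : ∀ x ∈ S, HasLineDerivAt ℝ g (g' x) x v)
    (hne : ∀ x ∈ S, g' x ≠ 0) : μ S = 0 := by
  let L : ℝ →L[ℝ] E := ContinuousLinearMap.smulRight (1 : ℝ →L[ℝ] ℝ) v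
  have key : ∀ᵐ x ∂μ, x ∈ Sᶜ := by
    -- Fubini along lines in direction `v`: on each line a zero with nonzero derivative is isolated,
    -- so the line meets `S` in a countable set.
    refine ae_mem_of_ae_add_linearMap_mem L.toLinearMap volume μ hS.compl fun x => ?_
    have hc : {t : ℝ | x + L t ∈ S}.Countable := by
      refine Set.countable_of_forall_eventually_notMem fun t ht => ?_
      have h1 := hd _ ht
      have h2 : HasDerivAt (fun s => g (x + L s)) (g' (x + L t)) t := by
        have h3 : HasDerivAt (fun s => g (x + L t + s • v)) (g' (x + L t)) (t - t) := by
          rw [sub_self]; exact h1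
        have h4 := h3.comp_sub_const t t
        suffices h6 : (fun s => g (x + L s)) = fun s => g (x + L t + (s - t) • v) by
          rw [h6]; exact h4
        ext s
        have hL : ∀ r, L r = r • v := fun r => rfl
        rw [hL, hL]
        congr 1
        module
      have h5 := h2.eventually_ne (c := 0) (hne _ ht)
      filter_upwards [h5] with s hs hsS
      exact hs (h0 _ hsS)
    filter_upwards [hc.ae_notMem volume] with t ht using ht
  rw [ae_iff] at key
  simpa using key

/-- A Lipschitz cutoff that vanishes on `[-η, η]` and equals one outside `[-2η, 2η]`. -/
noncomputable def cutoffSlope (η u : ℝ) : ℝ := max 0 (min 1 (|u| / η - 1))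

theorem continuous_cutoffSlope (η : ℝ) : Continuous (cutoffSlope η) := by
  unfold cutoffSlope; fun_prop

theorem abs_cutoffSlope_le (η u : ℝ) : |cutoffSlope η u| ≤ 1 := by
  unfold cutoffSlope
  rw [abs_of_nonneg (le_max_left _ _)]
  exact max_le zero_le_one (min_le_left _ _)

theorem cutoffSlope_eq_zero {η u : ℝ} (hη : 0 < η) (hu : |u| ≤ η) : cutoffSlope η u = 0 := by
  unfold cutoffSlope
  refine max_eq_left ((min_le_right _ _).trans ?_)
  rw [sub_nonpos, div_le_one hη]
  exact hu

theorem cutoffSlope_eq_one {η u : ℝ} (hη : 0 < η) (hu : 2 * η ≤ |u|) : cutoffSlope η u = 1 := by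
  unfold cutoffSlope
  have : 1 ≤ |u| / η - 1 := by
    rw [le_sub_iff_add_le, le_div_iff₀ hη]; linarith
  rw [min_eq_left this]; simp

/-- The divergence theorem in one direction, for a function that vanishes at the boundary. -/
theorem setIntegral_fderiv_eq_zero_of_vanishesAtBoundary {d : ℕ}
    {X : Set (EuclideanSpace ℝ (Fin d))} (hX : MeasurableSet X)
    {g : EuclideanSpace ℝ (Fin d) → ℝ} (hg : ∀ x ∈ X, DifferentiableAt ℝ g x)
    (hb : VanishesAtBoundary X g) (v : EuclideanSpace ℝ (Fin d))
    (hi : IntegrableOn (fun x => fderiv ℝ g x v) X) : ∫ x in X, fderiv ℝ g x v = 0 := by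
  classical
  let G := X.indicator g
  let D := X.indicator fun x => fderiv ℝ g x v
  have hGm : Measurable G := by
    have := ContinuousOn.measurable_piecewise (f := g) (g := 0) (s := X)
      (fun x hx => (hg x hx).continuousAt.continuousWithinAt) continuousOn_const hX
    rwa [piecewise_eq_indicator] at this
  have hDm : Measurable D := (measurable_fderiv_apply_const ℝ g v).indicator hX
  have hDi : Integrable D := (integrable_indicator_iff hX).2 hi
  rw [← integral_indicator hX]
  change ∫ x, D x = 0
  have hnull : volume ({x | G x = 0} ∩ {x | D x ≠ 0}) = 0 := by
    refine measure_zeros_lineDeriv_ne_zero volume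
      ((hGm (measurableSet_singleton 0)).inter (hDm (measurableSet_singleton 0).compl))
      (g := g) (g' := D) (v := v) ?_ ?_ ?_
    · rintro x ⟨hx0, hxD⟩
      have hxX : x ∈ X := mem_of_indicator_ne_zero hxD
      exact (indicator_of_mem hxX g).symm.trans hx0
    · rintro x ⟨hx0, hxD⟩
      have hxX : x ∈ X := mem_of_indicator_ne_zero hxD
      have : D x = fderiv ℝ g x v := indicator_of_mem hxX _
      rw [this]
      exact (hg x hxX).hasFDerivAt.hasLineDerivAt v
    · exact fun x hx => hx.2
  -- the truncated functions have compact support, so their derivatives integrate to zero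
  have htrunc : ∀ η : ℝ, 0 < η → ∫ x, cutoffSlope η (G x) * D x = 0 := by
    intro η hη
    obtain ⟨K, hK, hKX, hKs⟩ := hb η hη
    -- This `ψ` is `C¹` and vanishes on `[-η, η]`, so `ψ ∘ G` is supported in `K`.
    let ψ : ℝ → ℝ := fun s => ∫ u in (0 : ℝ)..s, cutoffSlope η u
    have hψ : ∀ s, HasDerivAt ψ (cutoffSlope η s) s := fun s =>
      (continuous_cutoffSlope η).integral_hasStrictDerivAt 0 s |>.hasDerivAt
    have hψ0 : ∀ s, |s| ≤ η → ψ s = 0 := by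
      intro s hs
      have : ∀ u ∈ uIcc 0 s, cutoffSlope η u = 0 := fun u hu =>
        cutoffSlope_eq_zero hη (by
          have := abs_sub_left_of_mem_uIcc hu
          simp only [sub_zero] at this
          exact this.trans hs)
      change ∫ u in (0 : ℝ)..s, cutoffSlope η u = 0
      rw [intervalIntegral.integral_congr (g := fun _ => 0) this]
      simp
    have hGK : ∀ x ∉ K, |G x| < η := by
      intro x hx
      by_cases hxX : x ∈ X
      · simpa [G, hxX] using hKs x hxX hx
      · simpa [G, hxX] using hη
    -- On `K`, inside the interior of `X`, the extension `G` agrees with `g` nearby; off `K` the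
    -- composition is locally zero. The boundary of `X` never enters.
    have hd : ∀ x, DifferentiableAt ℝ (fun y => ψ (G y)) x ∧
        HasLineDerivAt ℝ (fun y => ψ (G y)) (cutoffSlope η (G x) * D x) x v := by
      intro x
      by_cases hx : x ∈ K
      · have hxX : x ∈ X := interior_subset (hKX hx)
        have hGg : G =ᶠ[𝓝 x] g := by
          filter_upwards [mem_interior_iff_mem_nhds.1 (hKX hx)] with y hy
          exact indicator_of_mem hy _
        have h1 : HasFDerivAt G (fderiv ℝ g x) x :=
          (hg x hxX).hasFDerivAt.congr_of_eventuallyEq hGg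
        have h2 := (hψ (G x)).comp_hasFDerivAt x h1
        refine ⟨h2.differentiableAt, ?_⟩
        have h3 := h2.hasLineDerivAt v
        have : D x = fderiv ℝ g x v := indicator_of_mem hxX _
        rw [this]
        exact h3
      · have h0 : (fun y => ψ (G y)) =ᶠ[𝓝 x] fun _ => 0 := by
          filter_upwards [hK.isClosed.isOpen_compl.mem_nhds hx] with y hy
          exact hψ0 _ (hGK y hy).le
        have h1 : HasFDerivAt (fun y => ψ (G y))
            (0 : EuclideanSpace ℝ (Fin d) →L[ℝ] ℝ) x :=
          (hasFDerivAt_const (0 : ℝ) x).congr_of_eventuallyEq h0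
        refine ⟨h1.differentiableAt, ?_⟩
        rw [cutoffSlope_eq_zero hη (hGK x hx).le, zero_mul]
        exact h1.hasLineDerivAt v
    have hcont : Continuous fun y => ψ (G y) :=
      continuous_iff_continuousAt.2 fun x => (hd x).1.continuousAt
    have hsupp : HasCompactSupport fun y => ψ (G y) :=
      HasCompactSupport.intro hK fun x hx => hψ0 _ (hGK x hx).le
    have hint : Integrable fun y => ψ (G y) := hcont.integrable_of_hasCompactSupport hsupp
    have hint' : Integrable fun x => cutoffSlope η (G x) * D x := by
      refine hDi.mono (((continuous_cutoffSlope η).measurable.comp hGm).mul hDm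
        ).aestronglyMeasurable (ae_of_all _ fun x => ?_)
      rw [norm_mul]
      exact mul_le_of_le_one_left (norm_nonneg _) (abs_cutoffSlope_le _ _)
    -- Integration by parts against the constant function 1.
    have := integral_bilinear_hasLineDerivAt_right_eq_neg_left_of_integrable
      (μ := (volume : Measure (EuclideanSpace ℝ (Fin d)))) (f := fun _ => (1 : ℝ))
      (f' := fun _ => (0 : ℝ)) (g := fun y => ψ (G y)) (g' := fun x => cutoffSlope η (G x) * D x)
      (v := v) (B := ContinuousLinearMap.mul ℝ ℝ) (by simp) (by simpa using hint')
      (by simpa using hint) (fun x _ => (hasFDerivAt_const (1 : ℝ) x).hasLineDerivAt v)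
      (fun x _ => (hd x).2)
    simpa using this
  have hlim : Tendsto (fun n : ℕ => ∫ x, cutoffSlope (1 / ((n : ℝ) + 1)) (G x) * D x) atTop
      (𝓝 (∫ x, D x)) := by
    refine tendsto_integral_of_dominated_convergence (fun x => ‖D x‖) (fun n => ?_) hDi.norm
      (fun n => ae_of_all _ fun x => ?_) ?_
    · exact (((continuous_cutoffSlope _).measurable.comp hGm).mul hDm).aestronglyMeasurable
    · rw [norm_mul]
      exact mul_le_of_le_one_left (norm_nonneg _) (abs_cutoffSlope_le _ _)
    -- Almost everywhere, `D x ≠ 0` forces `G x ≠ 0`, and then the cutoff equals 1 for all large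
    -- `n`.
    · have hae : ∀ᵐ x, ¬ (x ∈ {x | G x = 0} ∩ {x | D x ≠ 0}) := measure_eq_zero_iff_ae_notMem.1 hnull
      filter_upwards [hae] with x hx
      by_cases hD : D x = 0
      · simp [hD]
      · have hG : G x ≠ 0 := fun h => hx ⟨h, hD⟩
        refine tendsto_const_nhds.congr' ?_
        have h1 : ∀ᶠ n : ℕ in atTop, 1 / ((n : ℝ) + 1) < |G x| / 2 :=
          tendsto_one_div_add_atTop_nhds_zero_nat.eventually_lt_const
            (by have := abs_pos.2 hG; positivity)
        filter_upwards [h1] with n hn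
        rw [cutoffSlope_eq_one (by positivity) (by linarith), one_mul]
  refine tendsto_nhds_unique hlim ?_
  simp_rw [htrunc _ Nat.one_div_pos_of_nat]
  exact tendsto_const_nhds

/-! ### High-probability uniform deviation. -/

theorem abs_ciSup_sub_ciSup_le {ι : Sort*} [Nonempty ι] {u u' : ι → ℝ} {c : ℝ}
    (hu : BddAbove (range u)) (hu' : BddAbove (range u')) (h : ∀ i, |u i - u' i| ≤ c) :
    |(⨆ i, u i) - ⨆ i, u' i| ≤ c := by
  rw [abs_sub_le_iff, sub_le_iff_le_add, sub_le_iff_le_add]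
  constructor
  · exact ciSup_le fun i => by linarith [(abs_le.1 (h i)).2, le_ciSup hu' i]
  · exact ciSup_le fun i => by linarith [(abs_le.1 (h i)).1, le_ciSup hu i]

/-- A uniform deviation bound for empirical means in terms of an upper bound of the empirical
Rademacher averages. -/
theorem measure_not_deviation_le {T W : Type*} [MeasurableSpace T] [StandardBorelSpace T]
    [Nonempty T] [MeasurableSpace W] (μ : Measure W) [IsProbabilityMeasure μ] {m : ℕ} (hm : 0 < m)
    {h : T → W → ℝ} (hh : Measurable (Function.uncurry h)) {B : ℝ} (hB0 : 0 < B)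
    (hB : ∀ t w, |h t w| ≤ B)
    {Q : (Fin m → W) → ℝ} (hQi : Integrable Q (Measure.pi fun _ => μ))
    (hQ : ∀ w, (1 / (2 : ℝ) ^ m) * ∑ σ : Fin m → ℤˣ,
      ⨆ t, (1 / (m : ℝ)) * ∑ l, ((σ l : ℤ) : ℝ) * h t (w l) ≤ Q w)
    {q : ℝ} (hq : ∫ w, Q w ∂(Measure.pi fun _ => μ) ≤ q) {δ : ℝ} (hδ : 0 < δ) (hδ1 : δ ≤ 1) :
    (Measure.pi fun _ : Fin m => μ) {w | ¬ ∀ t, ∫ x, h t x ∂μ - (1 / (m : ℝ)) * ∑ l, h t (w l) ≤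
      2 * q + 2 * B * √(2 * Real.log (1 / δ)) / √(m : ℝ)} ≤ ENNReal.ofReal δ := by
  have hm' : (0 : ℝ) < m := by exact_mod_cast hm
  let u : T → (Fin m → W) → ℝ := fun t w => ∫ x, h t x ∂μ - (1 / (m : ℝ)) * ∑ l, h t (w l)
  let Z : (Fin m → W) → ℝ := fun w => ⨆ t, u t w
  have hub : ∀ t w, |u t w| ≤ 2 * B := by
    intro t w
    refine (abs_sub _ _).trans ?_
    have h1 : |(1 / (m : ℝ)) * ∑ l, h t (w l)| ≤ B := abs_average_le hm fun l => hB t _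
    have h2 := norm_integral_le_of_norm_le_const (μ := μ) (f := h t) (C := B)
      (ae_of_all _ fun x => hB t x)
    simp only [Real.norm_eq_abs, probReal_univ, mul_one] at h2
    linarith
  have hum : Measurable (Function.uncurry u) := by
    change Measurable fun q : T × (Fin m → W) =>
      ∫ x, h q.1 x ∂μ - (1 / (m : ℝ)) * ∑ l, h q.1 (q.2 l)
    refine Measurable.sub ?_
      (Measurable.const_mul (Finset.measurable_fun_sum Finset.univ fun l _ => ?_) _)
    · have := (hh.stronglyMeasurable.integral_prod_right (ν := μ)).measurable
      exact this.comp measurable_fst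
    · exact hh.comp (measurable_fst.prodMk ((measurable_pi_apply l).comp measurable_snd))
  have hbdd : ∀ w, BddAbove (range fun t => u t w) := fun w =>
    bddAbove_range_of_abs_le fun t => hub t w
  have hZm : AEMeasurable Z (Measure.pi fun _ => μ) := hum.aemeasurable_iSup_param _ hbdd
  -- Replacing one sample point alters one summand of the average, by at most `2 * B`.
  let c : NNReal := ⟨2 * B / m, by positivity⟩
  have hsub := hasSubgaussianMGF_of_boundedDifferences μ c m hZm
    (fun w => abs_ciSup_le fun t => hub t w) (fun w i a => by
      refine abs_ciSup_sub_ciSup_le (hbdd _) (hbdd _) fun t => ?_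
      have h1 : u t (Function.update w i a) - u t w = (1 / (m : ℝ)) * (h t (w i) - h t a) := by
        have h2 : ∑ l, (h t (w l) - h t (Function.update w i a l)) = h t (w i) - h t a := by
          rw [Finset.sum_eq_single i]
          · simp
          · intro l _ hl; simp [hl]
          · simp
        simp only [u]
        rw [← h2, Finset.sum_sub_distrib]
        ring
      rw [h1, abs_mul, abs_of_nonneg (by positivity : 0 ≤ 1 / (m : ℝ))]
      change _ ≤ 2 * B / (m : ℝ)
      rw [one_div_mul_eq_div]
      gcongr
      exact (abs_sub _ _).trans (by linarith [hB t (w i), hB t a]))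
  have hEZ : ∫ w, Z w ∂(Measure.pi fun _ => μ) ≤ 2 * q :=
    (integral_iSup_deviation_le μ hm hh hB hQi hQ).trans (by linarith)
  -- Chosen so that the sub-Gaussian tail, with parameter `m * c ^ 2 = 4 * B ^ 2 / m`, equals `δ`.
  set e : ℝ := 2 * B * √(2 * Real.log (1 / δ)) / √(m : ℝ)
  have he : 0 ≤ e := by positivity
  have hlog : 0 ≤ Real.log (1 / δ) := Real.log_nonneg (by rw [le_div_iff₀ hδ]; linarith)
  have htail := hsub.measure_ge_le he
  have hexp : Real.exp (-e ^ 2 / (2 * ((m * c ^ 2 : NNReal) : ℝ))) = δ := by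
    have h1 : -e ^ 2 / (2 * ((m * c ^ 2 : NNReal) : ℝ)) = Real.log δ := by
      have hc : ((m * c ^ 2 : NNReal) : ℝ) = 4 * B ^ 2 / m := by
        have : (c : ℝ) = 2 * B / m := rfl
        push_cast
        rw [this]
        field_simp
        ring
      have he2 : e ^ 2 = 8 * B ^ 2 * Real.log (1 / δ) / m := by
        simp only [e]
        rw [div_pow, mul_pow, Real.sq_sqrt (by positivity), Real.sq_sqrt hm'.le]
        ring
      rw [hc, he2, one_div, Real.log_inv]
      field_simp
      ring
    rw [h1, Real.exp_log hδ]
  rw [hexp, measureReal_def] at htail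
  have hle := (ENNReal.le_ofReal_iff_toReal_le (measure_ne_top _ _) hδ.le).2 htail
  refine (measure_mono fun w hw => ?_).trans hle
  simp only [mem_ofPred_eq, not_forall, not_le] at hw ⊢
  obtain ⟨t, ht⟩ := hw
  have h1 : u t w ≤ Z w := le_ciSup (hbdd w) t
  change e ≤ Z w - ∫ w, Z w ∂(Measure.pi fun _ => μ)
  change 2 * q + e < u t w at ht
  linarith

/-! ### The Stein operator: measurability and Stein's identity. -/

section Stein

variable {d : ℕ} {W : Type*} [MeasurableSpace W] {X : Set (EuclideanSpace ℝ (Fin d))}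
  {p : EuclideanSpace ℝ (Fin d) → ℝ} {φ : EuclideanSpace ℝ (Fin d) → W → ℝ}

/-- Joint measurability of the `x`-derivative comes from difference quotients, which converge at
points of `X`; the indicator removes the other points. -/
theorem measurable_indicator_steinOp (hX : MeasurableSet X) (hφ : IsFeatureFamily X p φ)
    (j : Fin d) : Measurable (Function.uncurry fun x w =>
      X.indicator (fun x => steinOp p j (fun y => φ y w) x) x) := by
  classical
  set e : EuclideanSpace ℝ (Fin d) := EuclideanSpace.single j 1
  have hX' : MeasurableSet (Prod.fst ⁻¹' X : Set (EuclideanSpace ℝ (Fin d) × W)) :=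
    measurable_fst hX
  have hder : Measurable fun z : EuclideanSpace ℝ (Fin d) × W =>
      (Prod.fst ⁻¹' X).indicator (fun z => fderiv ℝ (fun y => φ y z.2) z.1 e) z := by
    let t : ℕ → ℝ := fun n => 1 / ((n : ℝ) + 1)
    have ht : Tendsto t atTop (𝓝[≠] 0) := tendsto_nhdsWithin_iff.2
      ⟨tendsto_one_div_add_atTop_nhds_zero_nat, Eventually.of_forall fun n =>
        (Nat.one_div_pos_of_nat (α := ℝ) (n := n)).ne'⟩
    refine measurable_of_tendsto_metrizable (f := fun n z => (Prod.fst ⁻¹' X).indicator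
      (fun z => (t n)⁻¹ • (φ (z.1 + t n • e) z.2 - φ z.1 z.2)) z) (fun n => ?_) ?_
    · refine Measurable.indicator ?_ hX'
      have h1 : Measurable fun z : EuclideanSpace ℝ (Fin d) × W => φ (z.1 + t n • e) z.2 :=
        hφ.measurable.comp ((measurable_fst.add_const _).prodMk measurable_snd)
      have h2 : Measurable fun z : EuclideanSpace ℝ (Fin d) × W => φ z.1 z.2 := hφ.measurable
      exact (h1.sub h2).const_mul ((t n)⁻¹)
    · rw [tendsto_pi_nhds]
      rintro ⟨x, w⟩
      by_cases hx : x ∈ X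
      · simp only [indicator, mem_preimage, hx, if_true]
        exact ((hφ.differentiableAt w x hx).hasFDerivAt.hasLineDerivAt e).tendsto_slope_zero.comp ht
      · simp only [indicator, mem_preimage, hx, if_false]
        exact tendsto_const_nhds
  have hlog : Measurable fun z : EuclideanSpace ℝ (Fin d) × W =>
      (Prod.fst ⁻¹' X).indicator
        (fun z => fderiv ℝ (fun y => Real.log (p y)) z.1 e * φ z.1 z.2) z :=
    ((((measurable_fderiv_apply_const ℝ _ e).comp measurable_fst).mul
      hφ.measurable)).indicator hX'
  convert hlog.add hder using 1
  ext ⟨x, w⟩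
  by_cases hx : x ∈ X
  · simp [Function.uncurry, indicator, hx, steinOp, e]
  · simp [Function.uncurry, indicator, hx]

theorem measurable_steinOp_subtype (hX : MeasurableSet X) (hφ : IsFeatureFamily X p φ)
    (j : Fin d) : Measurable (Function.uncurry fun (x : X) w =>
      steinOp p j (fun y => φ y w) x.1) := by
  have h := (measurable_indicator_steinOp hX hφ j).comp
    ((measurable_subtype_coe (p := (· ∈ X))).prodMap (measurable_id (α := W)))
  convert h using 1
  ext ⟨x, w⟩
  simp [Function.uncurry, x.2]

theorem IsTargetDensity.isProbabilityMeasure (hp : IsTargetDensity X p) :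
    IsProbabilityMeasure (targetMeasure X p) :=
  ⟨by rw [targetMeasure, withDensity_apply _ MeasurableSet.univ, Measure.restrict_univ,
    hp.lintegral_eq_one]⟩

theorem IsTargetDensity.nonempty (hp : IsTargetDensity X p) : X.Nonempty := by
  rw [nonempty_iff_ne_empty]
  rintro rfl
  simpa using hp.lintegral_eq_one

theorem IsTargetDensity.ae_mem (hp : IsTargetDensity X p) :
    ∀ᵐ x ∂(targetMeasure X p), x ∈ X :=
  (withDensity_absolutelyContinuous _ _).ae_le (ae_restrict_mem hp.measurableSet)

/-- Stein's identity. -/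
theorem integral_steinOp_eq_zero (hp : IsTargetDensity X p) (hφ : IsFeatureFamily X p φ)
    (j : Fin d) {K : ℝ} (hK : ∀ x ∈ X, ∀ w, |steinOp p j (fun y => φ y w) x| ≤ K) (w : W) :
    ∫ x, X.indicator (fun x => steinOp p j (fun y => φ y w) x) x ∂(targetMeasure X p) = 0 := by
  have hprob := hp.isProbabilityMeasure
  have hpm : AEMeasurable (fun x => (p x).toNNReal) (volume.restrict X) := by
    have : ContinuousOn p X := fun x hx =>
      (hp.differentiableAt x hx).continuousAt.continuousWithinAt
    exact (this.aemeasurable hp.measurableSet).real_toNNReal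
  set e : EuclideanSpace ℝ (Fin d) := EuclideanSpace.single j 1
  have hmeas : Measurable fun x => X.indicator (fun x => steinOp p j (fun y => φ y w) x) x :=
    (measurable_indicator_steinOp hp.measurableSet hφ j).comp (measurable_prodMk_right (y := w))
  obtain ⟨x₀, hx₀⟩ := hp.nonempty
  have hint : Integrable (fun x => X.indicator (fun x => steinOp p j (fun y => φ y w) x) x)
      (targetMeasure X p) := by
    refine Integrable.of_bound hmeas.aestronglyMeasurable K (ae_of_all _ fun x => ?_)
    by_cases hx : x ∈ X
    · simpa [hx] using hK x hx w
    · simpa [hx] using (abs_nonneg _).trans (hK x₀ hx₀ w)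
  -- Since `p ∂ⱼ log p = ∂ⱼ p`, weighting by `p` turns the Stein operator into the plain derivative
  -- `∂ⱼ(p φ)`.
  have heq : ∀ x ∈ X, (p x).toNNReal • X.indicator (fun x => steinOp p j (fun y => φ y w) x) x =
      fderiv ℝ (fun x => p x * φ x w) x e := by
    intro x hx
    have hpx := hp.pos x hx
    rw [indicator_of_mem hx, NNReal.smul_def, Real.coe_toNNReal _ hpx.le, smul_eq_mul, steinOp,
      fderiv_fun_mul (hp.differentiableAt x hx) (hφ.differentiableAt w x hx),
      fderiv.log (hp.differentiableAt x hx) hpx.ne']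
    simp only [add_apply, smul_apply, smul_eq_mul]
    field_simp
    ring
  have hint' : IntegrableOn (fun x => fderiv ℝ (fun x => p x * φ x w) x e) X := by
    have h1 := (integrable_withDensity_iff_integrable_smul₀ hpm).1 hint
    exact h1.congr (by
      filter_upwards [ae_restrict_mem hp.measurableSet] with x hx using heq x hx)
  have h2 : ∫ x, X.indicator (fun x => steinOp p j (fun y => φ y w) x) x ∂(targetMeasure X p) =
      ∫ x in X, fderiv ℝ (fun x => p x * φ x w) x e := by
    rw [← setIntegral_congr_fun hp.measurableSet heq]
    exact integral_withDensity_eq_integral_smul₀ hpm _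
  rw [h2]
  exact setIntegral_fderiv_eq_zero_of_vanishesAtBoundary hp.measurableSet
    (fun x hx => (hp.differentiableAt x hx).mul (hφ.differentiableAt w x hx)) (hφ.boundary w) e
    hint'

theorem abs_sum_mul_le {d : ℕ} {a b V K : Fin d → ℝ} (ha : ∀ j, |a j| ≤ V j)
    (hb : ∀ j, |b j| ≤ K j) : |∑ j, a j * b j| ≤ ∑ j, V j * K j := by
  refine (Finset.abs_sum_le_sum_abs _ _).trans (Finset.sum_le_sum fun j _ => ?_)
  rw [abs_mul]
  exact mul_le_mul (ha j) (hb j) (abs_nonneg _) ((abs_nonneg _).trans (ha j))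

/-- Functions in `F_∞` are integrable with mean zero under the target. -/
theorem integrable_and_integral_eq_zero_of_mem_representations (hp : IsTargetDensity X p)
    (hφ : IsFeatureFamily X p φ) {μ : Measure W} [IsProbabilityMeasure μ] {K V : Fin d → ℝ}
    (hK : ∀ j, ∀ x ∈ X, ∀ w, |steinOp p j (fun y => φ y w) x| ≤ K j)
    {f : EuclideanSpace ℝ (Fin d) → ℝ} {v : W → Fin d → ℝ} (hv : v ∈ representations μ X p φ f)
    (hV : ∀ w j, |v w j| ≤ V j) :
    Integrable f (targetMeasure X p) ∧ ∫ x, f x ∂(targetMeasure X p) = 0 := by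
  obtain ⟨hvm, -, hf⟩ := hv
  have hprob := hp.isProbabilityMeasure
  obtain ⟨x₀, hx₀⟩ := hp.nonempty
  let A : Fin d → EuclideanSpace ℝ (Fin d) → W → ℝ := fun j x w =>
    X.indicator (fun x => steinOp p j (fun y => φ y w) x) x
  have hA : ∀ j x w, |A j x w| ≤ K j := by
    intro j x w
    by_cases hx : x ∈ X
    · simpa [A, hx] using hK j x hx w
    · simpa [A, hx] using (abs_nonneg _).trans (hK j x₀ hx₀ w)
  have hterm : ∀ j, Measurable fun z : EuclideanSpace ℝ (Fin d) × W =>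
      v z.2 j * A j z.1 z.2 := fun j =>
    ((measurable_pi_apply j).comp (hvm.comp measurable_snd)).mul
      (measurable_indicator_steinOp hp.measurableSet hφ j)
  have hHm : Measurable fun z : EuclideanSpace ℝ (Fin d) × W => ∑ j, v z.2 j * A j z.1 z.2 :=
    Finset.measurable_fun_sum _ fun j _ => hterm j
  have hHb : ∀ x w, |∑ j, v w j * A j x w| ≤ ∑ j, V j * K j := fun x w =>
    abs_sum_mul_le (hV w) fun j => hA j x w
  have hHi : Integrable (fun z : EuclideanSpace ℝ (Fin d) × W => ∑ j, v z.2 j * A j z.1 z.2)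
      ((targetMeasure X p).prod μ) :=
    Integrable.of_bound hHm.aestronglyMeasurable _ (ae_of_all _ fun z => hHb z.1 z.2)
  have hae : f =ᵐ[targetMeasure X p] fun x => ∫ w, ∑ j, v w j * A j x w ∂μ := by
    filter_upwards [hp.ae_mem] with x hx
    rw [hf x hx]
    simp [A, hx]
  refine ⟨hHi.integral_prod_left.congr hae.symm, ?_⟩
  -- After exchanging the integrals, the inner one vanishes for each `w`, because the weights do not
  -- depend on `x`.
  rw [integral_congr_ae hae, integral_integral_swap hHi]
  have hw : ∀ w, ∫ x, ∑ j, v w j * A j x w ∂(targetMeasure X p) = 0 := by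
    intro w
    rw [integral_finsetSum]
    · refine Finset.sum_eq_zero fun j _ => ?_
      rw [integral_const_mul, integral_steinOp_eq_zero hp hφ j (hK j) w, mul_zero]
    · intro j _
      refine Integrable.of_bound ((hterm j).comp
        (measurable_prodMk_right (y := w))).aestronglyMeasurable (V j * K j) (ae_of_all _ fun x => ?_)
      rw [Real.norm_eq_abs, abs_mul]
      exact mul_le_mul (hV w j) (hA j x w) (abs_nonneg _) ((abs_nonneg _).trans (hV w j))
  simp [hw]

end Stein

/-! ### Deviation of the random feature expansion. -/

/-- Cauchy–Schwarz; with `s = 2` it turns the coordinatewise constants into the Euclidean ones `M`,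
`R` and `ε`. -/
theorem sum_mul_le_of_sum_sq_le {ι : Type*} [Fintype ι] {V K : ι → ℝ} {s b : ℝ} (hs : 0 ≤ s)
    (hb : 0 ≤ b) (hV : ∑ j, V j ^ 2 ≤ s ^ 2) (hK : b ^ 2 = ∑ j, K j ^ 2) :
    ∑ j, V j * K j ≤ s * b := by
  refine (Real.sum_mul_le_sqrt_mul_sqrt _ V K).trans ?_
  rw [← hK, Real.sqrt_sq hb]
  gcongr
  exact Real.sqrt_le_iff.2 ⟨hs, hV⟩

section Stein

variable {d m : ℕ} {W : Type*} {X : Set (EuclideanSpace ℝ (Fin d))}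
  {p : EuclideanSpace ℝ (Fin d) → ℝ} {φ : EuclideanSpace ℝ (Fin d) → W → ℝ}

/-- Indexing by points of `X` instead of functions puts the supremum over a standard Borel space. -/
theorem empiricalRademacher_steinClass (j : Fin d) (w : Fin m → W) :
    empiricalRademacher (steinClass X p φ j) w = (1 / (2 : ℝ) ^ m) * ∑ σ : Fin m → ℤˣ,
      ⨆ x : X, (1 / (m : ℝ)) * ∑ l, ((σ l : ℤ) : ℝ) *
        steinOp p j (fun y => φ y (w l)) x.1 := by
  let e : X → steinClass X p φ j := fun x =>
    ⟨fun w => steinOp p j (fun y => φ y w) x.1, x.1, x.2, rfl⟩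
  have he : Function.Surjective e := by
    rintro ⟨g, x, hx, rfl⟩
    exact ⟨⟨x, hx⟩, rfl⟩
  unfold empiricalRademacher
  congr 1
  refine Finset.sum_congr rfl fun σ _ => ?_
  exact (he.iSup_comp fun g : steinClass X p φ j =>
    (1 / (m : ℝ)) * ∑ l, ((σ l : ℤ) : ℝ) * g.1 (w l)).symm

/-- The supremum of the sum over `j` is at most the sum of suprema, and contraction removes the
weights in each coordinate. -/
theorem rademacher_weighted_le [Nonempty X] (hm : 0 < m) {K V : Fin d → ℝ}
    (hK : ∀ j, ∀ x ∈ X, ∀ w, |steinOp p j (fun y => φ y w) x| ≤ K j)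
    (hV0 : ∀ j, 0 ≤ V j) {v : W → Fin d → ℝ} (hV : ∀ w j, |v w j| ≤ V j) (w : Fin m → W) :
    (1 / (2 : ℝ) ^ m) * ∑ σ : Fin m → ℤˣ, ⨆ x : X, (1 / (m : ℝ)) * ∑ l, ((σ l : ℤ) : ℝ) *
        ∑ j, v (w l) j * steinOp p j (fun y => φ y (w l)) x.1 ≤
      ∑ j, V j * empiricalRademacher (steinClass X p φ j) w := by
  have h1 : ∀ σ : Fin m → ℤˣ, (⨆ x : X, (1 / (m : ℝ)) * ∑ l, ((σ l : ℤ) : ℝ) *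
        ∑ j, v (w l) j * steinOp p j (fun y => φ y (w l)) x.1) ≤
      ∑ j, ⨆ x : X, (1 / (m : ℝ)) * ∑ l, ((σ l : ℤ) : ℝ) *
        (v (w l) j * steinOp p j (fun y => φ y (w l)) x.1) := by
    intro σ
    refine ciSup_le fun x => ?_
    have h2 : (1 / (m : ℝ)) * ∑ l, ((σ l : ℤ) : ℝ) *
        ∑ j, v (w l) j * steinOp p j (fun y => φ y (w l)) x.1 =
        ∑ j, (1 / (m : ℝ)) * ∑ l, ((σ l : ℤ) : ℝ) *
        (v (w l) j * steinOp p j (fun y => φ y (w l)) x.1) := by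
      simp only [Finset.mul_sum]
      exact Finset.sum_comm
    rw [h2]
    refine Finset.sum_le_sum fun j _ => ?_
    refine le_ciSup (f := fun x : X => (1 / (m : ℝ)) * ∑ l, ((σ l : ℤ) : ℝ) *
        (v (w l) j * steinOp p j (fun y => φ y (w l)) x.1))
      (bddAbove_range_of_abs_le (B := V j * K j) fun x => abs_average_le hm fun l => ?_) x
    rw [abs_sign_mul, abs_mul]
    exact mul_le_mul (hV _ j) (hK j _ x.2 _) (abs_nonneg _) (hV0 j)
  calc _ ≤ (1 / (2 : ℝ) ^ m) * ∑ σ : Fin m → ℤˣ, ∑ j, ⨆ x : X, (1 / (m : ℝ)) *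
        ∑ l, ((σ l : ℤ) : ℝ) * (v (w l) j * steinOp p j (fun y => φ y (w l)) x.1) := by
        gcongr with σ
        exact h1 σ
    _ = ∑ j, (1 / (2 : ℝ) ^ m) * ∑ σ : Fin m → ℤˣ, ⨆ x : X, (1 / (m : ℝ)) *
        ∑ l, ((σ l : ℤ) : ℝ) * (v (w l) j * steinOp p j (fun y => φ y (w l)) x.1) := by
        rw [Finset.sum_comm, Finset.mul_sum]
    _ ≤ _ := by
        refine Finset.sum_le_sum fun j _ => ?_
        rw [empiricalRademacher_steinClass]
        have := rademacher_contraction (ι := X) hm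
          (g := fun x l => steinOp p j (fun y => φ y (w l)) x.1)
          (fun x l => hK j x.1 x.2 (w l)) (hV0 j) (a := fun l => v (w l) j) (fun l => hV _ j)
        calc _ ≤ (1 / (2 : ℝ) ^ m) * (V j * _) := by gcongr
          _ = _ := by ring

variable [MeasurableSpace W]

/-- The uniform one-sided deviation between the random feature expansion and its limit. -/
theorem measure_not_feature_deviation_le {n : ℕ} {Ω : Type*} [MeasurableSpace Ω] {P : Measure Ω}
    [IsProbabilityMeasure P] {μ : Measure W} [IsProbabilityMeasure μ] (hm : 0 < m)
    {feat : Fin m → Ω → W} {particles : Ω → Fin n → EuclideanSpace ℝ (Fin d)}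
    {ε' M' R' : Fin d → ℝ} (hp : IsTargetDensity X p) (hφ : IsFeatureFamily X p φ)
    (hA : RandomFeatureAssumption P μ X p φ feat particles ε' M' R')
    {R M : ℝ} (hR : 0 ≤ R) (hM : 0 ≤ M) (hM2 : M ^ 2 = ∑ j, M' j ^ 2)
    (hR2 : R ^ 2 = ∑ j, R' j ^ 2) {v : W → Fin d → ℝ} (hvm : Measurable v) {V : Fin d → ℝ}
    (hV0 : ∀ j, 0 ≤ V j) (hV : ∀ w j, |v w j| ≤ V j) (hV2 : ∑ j, V j ^ 2 ≤ 2 ^ 2)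
    {δ : ℝ} (hδ : 0 < δ) (hδ1 : δ ≤ 1) :
    P {ω | ¬ ∀ x ∈ X, ∫ w, ∑ j, v w j * steinOp p j (fun y => φ y w) x ∂μ -
      (1 / (m : ℝ)) * ∑ l, ∑ j, v (feat l ω) j * steinOp p j (fun y => φ y (feat l ω)) x ≤
      (4 * R + 2 * (2 * M + 1) * √(2 * Real.log (1 / δ))) / √(m : ℝ)} ≤ ENNReal.ofReal δ := by
  have hK : ∀ j, ∀ x ∈ X, ∀ w, |steinOp p j (fun y => φ y w) x| ≤ M' j := fun j x hx w =>
    (hA.isLUB j).1 ⟨x, hx, w, rfl⟩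
  have : StandardBorelSpace X := hp.measurableSet.standardBorel
  have : Nonempty X := hp.nonempty.to_subtype
  have hfeat : ∀ l, AEMeasurable (feat l) P := fun l => (hA.hasLaw l).aemeasurable
  have hlaw : P.map (fun ω l => feat l ω) = Measure.pi fun _ => μ := by
    rw [(iIndepFun_iff_map_fun_eq_pi_map hfeat).1 hA.indep]
    congr 1
    ext1 l
    exact (hA.hasLaw l).map_eq
  let h : X → W → ℝ := fun x w => ∑ j, v w j * steinOp p j (fun y => φ y w) x.1
  have hh : Measurable (Function.uncurry h) :=
    Finset.measurable_fun_sum _ fun j _ =>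
      ((measurable_pi_apply j).comp (hvm.comp measurable_snd)).mul
        (measurable_steinOp_subtype hp.measurableSet hφ j)
  -- The extra 1 keeps the bound positive when `M = 0`.
  have hB : ∀ x w, |h x w| ≤ 2 * M + 1 := fun x w =>
    (abs_sum_mul_le (hV w) fun j => hK j x.1 x.2 w).trans
      ((sum_mul_le_of_sum_sq_le zero_le_two hM hV2 hM2).trans (by linarith))
  have hQi : Integrable (fun w : Fin m → W => ∑ j, V j * empiricalRademacher (steinClass X p φ j) w)
      (Measure.pi fun _ => μ) :=
    integrable_finsetSum _ fun j _ => (hA.rademacher_integrable j).const_mul _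
  have hq : ∫ w : Fin m → W, ∑ j, V j * empiricalRademacher (steinClass X p φ j) w
      ∂(Measure.pi fun _ => μ) ≤ 2 * R / √(m : ℝ) := by
    rw [integral_finsetSum _ fun j _ => (hA.rademacher_integrable j).const_mul _]
    calc _ ≤ ∑ j, V j * (R' j / √(m : ℝ)) := by
          refine Finset.sum_le_sum fun j _ => ?_
          rw [integral_const_mul]
          exact mul_le_mul_of_nonneg_left (hA.rademacher_le j) (hV0 j)
      _ = (∑ j, V j * R' j) / √(m : ℝ) := by
          rw [Finset.sum_div]; exact Finset.sum_congr rfl fun j _ => by ring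
      _ ≤ _ := by
          gcongr
          exact sum_mul_le_of_sum_sq_le zero_le_two hR hV2 hR2
  have hdev := measure_not_deviation_le μ hm hh (by linarith : 0 < 2 * M + 1) hB hQi
    (fun w => rademacher_weighted_le hm hK hV0 hV w) hq hδ hδ1
  rw [← hlaw] at hdev
  -- The bad event need not be measurable; pulling it back from the product space still bounds its
  -- outer probability.
  refine ((measure_mono fun ω hω => ?_).trans
    (Measure.le_map_apply (aemeasurable_pi_lambda _ hfeat) _)).trans hdev
  simp only [mem_preimage, mem_ofPred_eq] at hω ⊢
  refine fun hall => hω fun x hx => (hall ⟨x, hx⟩).trans (le_of_eq ?_)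
  ring

end Stein

/-! ### Assembling the bound. -/

theorem exists_representation_sum_sq_lt {d : ℕ} {W : Type*} [MeasurableSpace W] {μ : Measure W}
    [Nonempty W] {X : Set (EuclideanSpace ℝ (Fin d))} {p : EuclideanSpace ℝ (Fin d) → ℝ}
    {φ : EuclideanSpace ℝ (Fin d) → W → ℝ} {f : EuclideanSpace ℝ (Fin d) → ℝ}
    (hf : MemFInfty μ X p φ f) (hnorm : fInftyNorm μ X p φ f ≤ 1) :
    ∃ v ∈ representations μ X p φ f, ∃ V : Fin d → ℝ, (∀ j, 0 ≤ V j) ∧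
      (∀ w j, |v w j| ≤ V j) ∧ ∑ j, V j ^ 2 ≤ 2 ^ 2 := by
  have hinf := (Real.sqrt_le_iff.1 hnorm).2
  rw [one_pow] at hinf
  -- The infimum need not be attained; relaxing the bound from 1 to 4 yields an actual
  -- representation.
  obtain ⟨_, ⟨v, hv, rfl⟩, hlt⟩ := exists_lt_of_csInf_lt (hf.image _)
    (hinf.trans_lt (by norm_num : (1 : ℝ) < 2 ^ 2))
  obtain ⟨B, hB⟩ := hv.2.1
  have hbdd : ∀ j, BddAbove (range fun w => |v w j| ^ 2) := fun j =>
    ⟨B ^ 2, by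
      rintro _ ⟨w, rfl⟩
      exact pow_le_pow_left₀ (abs_nonneg _) ((norm_le_pi_norm (v w) j).trans (hB w)) 2⟩
  have hnn : ∀ j, 0 ≤ ⨆ w, |v w j| ^ 2 := fun j => Real.iSup_nonneg fun w => by positivity
  refine ⟨v, hv, fun j => √(⨆ w, |v w j| ^ 2), fun j => Real.sqrt_nonneg _, fun w j => ?_, ?_⟩
  · exact Real.le_sqrt_of_sq_le (le_ciSup (hbdd j) w)
  · simp only [Real.sq_sqrt (hnn _)]
    exact hlt.le

/-- Halving the failure probability for the two one-sided bounds costs only an additive constant, as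
`2 log 2 < 4`. -/
theorem sqrt_two_mul_log_two_div_le {δ : ℝ} (hδ : 0 < δ) (hδ1 : δ ≤ 1) :
    √(2 * Real.log (1 / (δ / 2))) ≤ 2 + √(2 * Real.log (1 / δ)) := by
  have hlog : 0 ≤ Real.log (1 / δ) := Real.log_nonneg (by rw [le_div_iff₀ hδ]; linarith)
  have h1 : Real.log (1 / (δ / 2)) = Real.log 2 + Real.log (1 / δ) := by
    rw [← Real.log_mul (by norm_num) (by positivity)]
    congr 1
    field_simp
  rw [h1, Real.sqrt_le_iff]
  refine ⟨by positivity, ?_⟩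
  have h2 := Real.sq_sqrt (by positivity : 0 ≤ 2 * Real.log (1 / δ))
  nlinarith [Real.log_two_lt_d9, Real.sqrt_nonneg (2 * Real.log (1 / δ))]

/-- Exchanging sums writes the left side as an average over `l` of fixed point residuals weighted by
`v (w l)`. -/
theorem abs_empiricalMean_features_le {d m n : ℕ} {W : Type*} (hm : 0 < m)
    {p : EuclideanSpace ℝ (Fin d) → ℝ} {φ : EuclideanSpace ℝ (Fin d) → W → ℝ}
    {x : Fin n → EuclideanSpace ℝ (Fin d)} {w : Fin m → W} {ε' V : Fin d → ℝ} {ε : ℝ}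
    (hε : 0 ≤ ε) (hε2 : ε ^ 2 = ∑ j, ε' j ^ 2) {v : W → Fin d → ℝ} (hV : ∀ w j, |v w j| ≤ V j)
    (hV2 : ∑ j, V j ^ 2 ≤ 2 ^ 2)
    (hx : ∀ l j, |empiricalMean x (steinOp p j fun y => φ y (w l))| ≤ ε' j / √(m : ℝ)) :
    |empiricalMean x fun x => (1 / (m : ℝ)) * ∑ l, ∑ j, v (w l) j *
      steinOp p j (fun y => φ y (w l)) x| ≤ 2 * ε / √(m : ℝ) := by
  have h1 : (empiricalMean x fun x => (1 / (m : ℝ)) * ∑ l, ∑ j, v (w l) j *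
      steinOp p j (fun y => φ y (w l)) x) = (1 / (m : ℝ)) * ∑ l, ∑ j, v (w l) j *
        empiricalMean x (steinOp p j fun y => φ y (w l)) := by
    simp only [empiricalMean, Finset.mul_sum]
    rw [Finset.sum_comm]
    refine Finset.sum_congr rfl fun l _ => ?_
    rw [Finset.sum_comm]
    exact Finset.sum_congr rfl fun j _ => Finset.sum_congr rfl fun i _ => by ring
  rw [h1]
  refine abs_average_le hm fun l => (abs_sum_mul_le (hV _) (hx l)).trans ?_
  calc ∑ j, V j * (ε' j / √(m : ℝ)) = (∑ j, V j * ε' j) / √(m : ℝ) := by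
        rw [Finset.sum_div]; exact Finset.sum_congr rfl fun j _ => by ring
    _ ≤ _ := by
        gcongr
        exact sum_mul_le_of_sum_sq_le zero_le_two hε hV2 hε2

theorem mainTheorem5 (R M : ℝ) (hR : 0 ≤ R) (hM : 0 ≤ M) :
    ∃ C : ℝ, 0 < C ∧
      ∀ (d m n : ℕ), 0 < m → 0 < n →
      ∀ (Ω W : Type*) [MeasurableSpace Ω] [MeasurableSpace W]
        (P : Measure Ω) [IsProbabilityMeasure P] (μ : Measure W) [IsProbabilityMeasure μ]
        (X : Set (EuclideanSpace ℝ (Fin d))) (p : EuclideanSpace ℝ (Fin d) → ℝ)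
        (φ : EuclideanSpace ℝ (Fin d) → W → ℝ) (feat : Fin m → Ω → W)
        (particles : Ω → Fin n → EuclideanSpace ℝ (Fin d))
        (ε' M' R' : Fin d → ℝ) (ε : ℝ),
        IsTargetDensity X p →
        IsFeatureFamily X p φ →
        RandomFeatureAssumption P μ X p φ feat particles ε' M' R' →
        0 ≤ ε → ε ^ 2 = ∑ j, ε' j ^ 2 →
        M ^ 2 = ∑ j, M' j ^ 2 →
        R ^ 2 = ∑ j, R' j ^ 2 →
        ∀ f : EuclideanSpace ℝ (Fin d) → ℝ,
          MemFInfty μ X p φ f → fInftyNorm μ X p φ f ≤ 1 →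
          Integrable f (targetMeasure X p) ∧
          ∀ δ : ℝ, 0 < δ → δ ≤ 1 →
            -- bounding the outer probability of failure, as the particles need not be measurable
            P {ω | ¬ |empiricalMean (particles ω) f - ∫ x, f x ∂(targetMeasure X p)| ≤
                C / √(m : ℝ) * (1 + ε + √(2 * Real.log (1 / δ)))} ≤ ENNReal.ofReal δ := by
  -- `4 * R` comes from symmetrization and the norm slack 2, `4 * (2 * M + 1)` from the
  -- concentration term after halving `δ`, and 2 from the fixed point error `2 * ε`.
  refine ⟨4 * R + 4 * (2 * M + 1) + 2, by linarith, ?_⟩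
  intro d m n hm hn Ω W _ _ P _ μ _ X p φ feat particles ε' M' R' ε hp hφ hA hε hε2 hM2 hR2 f hf
    hnorm
  have : Nonempty W := nonempty_of_isProbabilityMeasure μ
  obtain ⟨v, hv, V, hV0, hV, hV2⟩ := exists_representation_sum_sq_lt hf hnorm
  obtain ⟨hfi, hf0⟩ := integrable_and_integral_eq_zero_of_mem_representations hp hφ
    (fun j x hx w => (hA.isLUB j).1 ⟨x, hx, w, rfl⟩) hv hV
  refine ⟨hfi, fun δ hδ hδ1 => ?_⟩
  rw [hf0]
  set b : ℝ := (4 * R + 2 * (2 * M + 1) * √(2 * Real.log (1 / (δ / 2)))) / √(m : ℝ) with hb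
  set Y : Ω → EuclideanSpace ℝ (Fin d) → ℝ := fun ω x =>
    (1 / (m : ℝ)) * ∑ l, ∑ j, v (feat l ω) j * steinOp p j (fun y => φ y (feat l ω)) x with hY
  have hdev : P {ω | ¬ ∀ x ∈ X, f x - Y ω x ≤ b} ≤ ENNReal.ofReal (δ / 2) := by
    have h1 := measure_not_feature_deviation_le hm hp hφ hA hR hM hM2 hR2 hv.1 hV0 hV hV2
      (half_pos hδ) (by linarith)
    refine (measure_mono fun ω hω => ?_).trans h1
    exact fun hall => hω fun x hx => by rw [hv.2.2 x hx]; exact hall x hx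
  -- The reverse inequality is the same bound applied to `-v`.
  have hdev' : P {ω | ¬ ∀ x ∈ X, Y ω x - f x ≤ b} ≤ ENNReal.ofReal (δ / 2) := by
    have h1 := measure_not_feature_deviation_le hm hp hφ hA hR hM hM2 hR2 hv.1.neg hV0
      (fun w j => by simpa using hV w j) hV2 (half_pos hδ) (by linarith)
    refine (measure_mono fun ω hω => ?_).trans h1
    refine fun hall => hω fun x hx => le_trans (le_of_eq ?_) (hall x hx)
    rw [hv.2.2 x hx]
    simp only [hY, Pi.neg_apply, neg_mul, Finset.sum_neg_distrib, integral_neg]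
    ring
  have hae : P {ω | ¬ ((∀ i, particles ω i ∈ X) ∧ ∀ l j,
      |empiricalMean (particles ω) (steinOp p j fun y => φ y (feat l ω))| ≤ ε' j / √(m : ℝ))} = 0 :=
    ae_iff.1 (hA.particles_mem.and hA.approx_fixed)
  have hmain : ∀ ω, (∀ x ∈ X, f x - Y ω x ≤ b) → (∀ x ∈ X, Y ω x - f x ≤ b) →
      (∀ i, particles ω i ∈ X) → (∀ l j, |empiricalMean (particles ω)
        (steinOp p j fun y => φ y (feat l ω))| ≤ ε' j / √(m : ℝ)) →
      |empiricalMean (particles ω) f - 0| ≤ (4 * R + 4 * (2 * M + 1) + 2) / √(m : ℝ) *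
        (1 + ε + √(2 * Real.log (1 / δ))) := by
    intro ω h1 h2 h3 h4
    -- The deviation bound holds at all points of `X` at once, hence at the feature-dependent
    -- particles.
    have h5 : |empiricalMean (particles ω) fun x => f x - Y ω x| ≤ b :=
      abs_average_le hn fun i =>
        abs_le.2 ⟨by linarith [h2 _ (h3 i)], h1 _ (h3 i)⟩
    have h6 : |empiricalMean (particles ω) (Y ω)| ≤ 2 * ε / √(m : ℝ) :=
      abs_empiricalMean_features_le hm (w := fun l => feat l ω) hε hε2 hV hV2 h4
    have h7 : empiricalMean (particles ω) f - 0 =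
        (empiricalMean (particles ω) fun x => f x - Y ω x) + empiricalMean (particles ω) (Y ω) := by
      simp only [empiricalMean, Finset.sum_sub_distrib]
      ring
    rw [h7]
    refine (abs_add_le _ _).trans ((add_le_add h5 h6).trans ?_)
    rw [hb, ← add_div, div_mul_eq_mul_div]
    gcongr
    have hs := sqrt_two_mul_log_two_div_le hδ hδ1
    have hs0 := Real.sqrt_nonneg (2 * Real.log (1 / δ))
    have h8 := mul_le_mul_of_nonneg_left hs (by linarith : 0 ≤ 2 * (2 * M + 1))
    nlinarith [mul_nonneg hR hε, mul_nonneg hR hs0, mul_nonneg hM hε, mul_nonneg hM hs0]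
  calc _ ≤ P ({ω | ¬ ∀ x ∈ X, f x - Y ω x ≤ b} ∪ {ω | ¬ ∀ x ∈ X, Y ω x - f x ≤ b} ∪
        {ω | ¬ ((∀ i, particles ω i ∈ X) ∧ ∀ l j,
          |empiricalMean (particles ω) (steinOp p j fun y => φ y (feat l ω))| ≤
            ε' j / √(m : ℝ))}) := by
        refine measure_mono fun ω hω => ?_
        by_contra hcon
        simp only [mem_union, mem_ofPred_eq, not_or, not_not] at hcon
        exact hω (hmain ω hcon.1.1 hcon.1.2 hcon.2.1 hcon.2.2)
    _ ≤ ENNReal.ofReal (δ / 2) + ENNReal.ofReal (δ / 2) + 0 :=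
        (measure_union_le _ _).trans (add_le_add
          ((measure_union_le _ _).trans (add_le_add hdev hdev')) hae.le)
    _ = ENNReal.ofReal δ := by
        rw [add_zero, ← ENNReal.ofReal_add (by linarith) (by linarith), add_halves]
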